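/- Let $\Sigma \subset \mathbb{S}^3 \subset \mathbb{R}^4$ be a smooth closed (compact, without boundary) embedded minimal surface in the round unit three-sphere, and let $N:\Sigma\to\mathbb{S}^3$ be a smooth unit normal vector field of $\Sigma$ in $\mathbb{S}^3$. For $x\in\Sigma$ let $\lambda_2(x)\ge 0$ be the non-negative principal curvature of $\Sigma$ at $x$ (by minimality the principal curvatures at $x$ are $\pm\lambda_2(x)$), and put \[ c=c(\Sigma)=\min\left\{\arctan\left(\frac{1}{\max\{\lambda_2(x):x\in\Sigma\}}\right),\ \frac{\pi}{4}\right\}, \] with the convention $\arctan(1/0)=\pi/2$ (so that $c=\pi/4$ if $\Sigma$ is totally geodesic). Then the normal exponential map \[ F:\Sigma\times[0,c)\to\mathbb{S}^3,\qquad F(x,t)=\cos(t)\,x+\sin(t)\,N(x), \] is a diffeomorphism onto its image: $F$ is smooth and injective, and its inverse $F(\Sigma\times[0,c))\to\Sigma\times[0,c)$ is smooth, in the sense that near every point of the image it extends to a smooth map from an open subset of $\mathbb{S}^3$ to $\Sigma\times\mathbb{R}$. -/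

import Mathlib

open Set Real Manifold ContDiff

noncomputable section

/-- `ℝ⁴` with its Euclidean inner product. -/
abbrev E4 : Type := EuclideanSpace ℝ (Fin 4)

/-- The round unit sphere `S³ ⊂ ℝ⁴`. -/
abbrev S3 : Type := Metric.sphere (0 : E4) 1

section Surface

variable {M : Type*} [TopologicalSpace M] [ChartedSpace (EuclideanSpace ℝ (Fin 2)) M]

/-- The differential at `x` of a map `f : M → S³` from a surface, regarded as a linear map
`T_x M → ℝ⁴` through the inclusion `S³ ⊂ ℝ⁴`. -/
def ambientDeriv (f : M → S3) (x : M) : TangentSpace (𝓡 2) x →L[ℝ] E4 :=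
  mfderiv (𝓡 2) 𝓘(ℝ, E4) (fun y => (f y : E4)) x

/-- `N` is a smooth unit normal vector field, tangent to `S³`, along `ι : M → S³`. It is regarded
as a map into `S³`, so that it has length one. -/
structure IsUnitNormalField (ι N : M → S3) : Prop where
  smooth : ContMDiff (𝓡 2) (𝓡 3) ∞ N
  orthogonal_position : ∀ x, inner ℝ (ι x : E4) (N x : E4) = 0
  orthogonal_tangent : ∀ x (v : TangentSpace (𝓡 2) x), inner ℝ (ambientDeriv ι x v) (N x : E4) = 0

/-- The metric induced by `ι` on `M` (first fundamental form). -/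
def firstFundamentalForm (ι : M → S3) (x : M) (v w : TangentSpace (𝓡 2) x) : ℝ :=
  inner ℝ (ambientDeriv ι x v) (ambientDeriv ι x w)

/-- The second fundamental form `A(v, w) = -⟨dN(v), dι(w)⟩` with respect to `N`. -/
def secondFundamentalForm (ι N : M → S3) (x : M) (v w : TangentSpace (𝓡 2) x) : ℝ :=
  -inner ℝ (ambientDeriv N x v) (ambientDeriv ι x w)

/-- Minimality: at every point the trace of the second fundamental form, computed in any basis of
the tangent plane that is orthonormal for the induced metric, is zero. -/
def IsMinimalSurface (ι N : M → S3) : Prop :=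
  ∀ (x : M) (e : Fin 2 → TangentSpace (𝓡 2) x),
    (∀ i j, firstFundamentalForm ι x (e i) (e j) = if i = j then 1 else 0) →
      ∑ i, secondFundamentalForm ι N x (e i) (e i) = 0

/-- `lam` is a principal curvature at `x`: an eigenvalue of the second fundamental form with respect
to the induced metric. -/
def IsPrincipalCurvature (ι N : M → S3) (x : M) (lam : ℝ) : Prop :=
  ∃ v : TangentSpace (𝓡 2) x, v ≠ 0 ∧
    ∀ w, secondFundamentalForm ι N x v w = lam * firstFundamentalForm ι x v w

/-- The non-negative principal curvature at `x`. On a minimal surface the two principal curvatures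
are `lam` and `-lam`, so the set below has exactly one element. -/
def nonnegPrincipalCurvature (ι N : M → S3) (x : M) : ℝ :=
  sSup {lam : ℝ | 0 ≤ lam ∧ IsPrincipalCurvature ι N x lam}

/-- The maximum over the surface of the non-negative principal curvature. -/
def maxPrincipalCurvature (ι N : M → S3) : ℝ :=
  ⨆ x, nonnegPrincipalCurvature ι N x

/-- `c = min {arctan (1 / max lam₂), π / 4}`, where `arctan (1 / 0) = arctan ∞ = π / 2`. -/
def rollingRadius (ι N : M → S3) : ℝ :=
  min (if maxPrincipalCurvature ι N = 0 then π / 2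
    else arctan (1 / maxPrincipalCurvature ι N)) (π / 4)

theorem cos_smul_add_sin_smul_mem (x y : S3) (h : inner ℝ (x : E4) (y : E4) = 0) (t : ℝ) :
    cos t • (x : E4) + sin t • (y : E4) ∈ Metric.sphere (0 : E4) 1 := by
  have hx : ‖(x : E4)‖ = 1 := by simp
  have hy : ‖(y : E4)‖ = 1 := by simp
  have h1 : ‖cos t • (x : E4) + sin t • (y : E4)‖ ^ 2 = 1 := by
    rw [norm_add_sq_real, real_inner_smul_left, real_inner_smul_right, h, norm_smul, norm_smul,
      hx, hy]
    simp
  rw [mem_sphere_zero_iff_norm]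
  nlinarith [norm_nonneg (cos t • (x : E4) + sin t • (y : E4))]

/-- The normal exponential map `F(x, t) = cos t • x + sin t • N(x)`. -/
def normalExp (ι N : M → S3) (hN : IsUnitNormalField ι N) (p : M × ℝ) : S3 :=
  ⟨cos p.2 • (ι p.1 : E4) + sin p.2 • (N p.1 : E4),
    cos_smul_add_sin_smul_mem (ι p.1) (N p.1) (hN.orthogonal_position p.1) p.2⟩

end Surface

/-- `f` restricts to a diffeomorphism from the subset `s` of the manifold `X` onto the subset `f '' s`
of the manifold `Y`: it is smooth and injective on `s`, and the inverse `f '' s → s` is smooth,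
that is, near every point of `f '' s` it extends to a smooth map on an open subset of `Y`. -/
def IsDiffeoOntoImageOn {E H E' H' X Y : Type*}
    [NormedAddCommGroup E] [NormedSpace ℝ E] [TopologicalSpace H]
    [NormedAddCommGroup E'] [NormedSpace ℝ E'] [TopologicalSpace H']
    (I : ModelWithCorners ℝ E H) (J : ModelWithCorners ℝ E' H')
    [TopologicalSpace X] [ChartedSpace H X] [TopologicalSpace Y] [ChartedSpace H' Y]
    (f : X → Y) (s : Set X) : Prop :=
  ContMDiffOn I J ∞ f s ∧ InjOn f s ∧
    ∀ x ∈ s, ∃ (U : Set Y) (g : Y → X), IsOpen U ∧ f x ∈ U ∧ ContMDiffOn J I ∞ g U ∧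
      ∀ y ∈ s, f y ∈ U → g (f y) = y

end

/-! The theorem amounts to rolling a ball. For `Φ = cot t` put Z(x, y) = Φ (1 - ⟨x, y⟩) - ⟨N(x), y⟩
(`ballDefect`). That Z(x, y) ≥ 0 for all y means that the geodesic ball of radius t touching Σ at x
from the side of N has no point of Σ in its interior. If this holds for all t < c, then F is
injective: when F(x, t) = F(y, s) the radii agree, and if x ≠ y a slightly larger ball at x would
swallow y (`normalExp_eq_imp_eq`).

That Z ≥ 0 whenever Φ ≥ 1 exceeds all principal curvatures is a two-point maximum principle
(`ballDefect_nonneg`). Some large parameter works, by compactness. If the least working parameter Ψ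
≥ Φ were larger than Φ, then Z would vanish for Ψ at some x ≠ y, because near the diagonal the
curvature bound keeps Z ≥ 0 already for Φ (`IsSurfacePatch.eventually_nonneg`). At such a pair the
first variation puts y in the span of x and N(x) and makes the two tangent planes coincide. The
second variation, summed over two well-chosen pairs of directions, is then negative: minimality at
both points removes the uncontrolled terms, and Φ ≥ 1 enters through ⟨x, y⟩ ≥ 0
(`IsSurfacePatch.position_eq_of_touching`).

For smoothness of the inverse, the cone r F(x, t) is a local diffeomorphism into ℝ⁴ before the focal
distance, and its inverse restricted to the sphere inverts F locally
(`exists_local_inverse_normalExp`). Compactness of Σ × [0, c] upgrades this to an inverse on all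
points of the image near a given one. -/

noncomputable section

/-! ### Calculus: differentiated orthogonality relations and second derivative tests. -/

section Calculus

open Filter Topology

variable {E F : Type*} [NormedAddCommGroup E] [NormedSpace ℝ E]
  [NormedAddCommGroup F] [InnerProductSpace ℝ F]

/-- Differentiating an orthogonality relation `⟨df(w), g⟩ = 0`. -/
theorem inner_fderiv_fderiv_of_orthogonal {f g : E → F} {T : Set E} (hT : IsOpen T)
    (hf : ContDiffOn ℝ ∞ f T) (hg : ContDiffOn ℝ ∞ g T)
    (h : ∀ u ∈ T, ∀ w, inner ℝ (fderiv ℝ f u w) (g u) = 0) {u : E} (hu : u ∈ T) (v w : E) :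
    inner ℝ (fderiv ℝ (fderiv ℝ f) u v w) (g u) = -inner ℝ (fderiv ℝ f u w) (fderiv ℝ g u v) := by
  have hfa : ContDiffAt ℝ ∞ f u := hf.contDiffAt (hT.mem_nhds hu)
  have hga : ContDiffAt ℝ ∞ g u := hg.contDiffAt (hT.mem_nhds hu)
  have hd : HasFDerivAt (fderiv ℝ f) (fderiv ℝ (fderiv ℝ f) u) u :=
    ((hfa.fderiv_right (m := ∞) (by simp)).differentiableAt
      (by simp)).hasFDerivAt
  have hdw : HasFDerivAt (fun u => fderiv ℝ f u w)
      ((ContinuousLinearMap.apply ℝ F w).comp (fderiv ℝ (fderiv ℝ f) u)) u :=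
    (ContinuousLinearMap.apply ℝ F w).hasFDerivAt.comp u hd
  have hdg : HasFDerivAt g (fderiv ℝ g u) u := (hga.differentiableAt (by simp)).hasFDerivAt
  have h1 := hdw.inner ℝ hdg
  have h2 : HasFDerivAt (fun t => inner ℝ (fderiv ℝ f t w) (g t)) (0 : E →L[ℝ] ℝ) u := by
    refine (hasFDerivAt_const (0 : ℝ) u).congr_of_eventuallyEq ?_
    filter_upwards [hT.mem_nhds hu] with t ht
    exact h t ht w
  have h3 := congrArg (fun L => L v) (h1.unique h2)
  simp [fderivInnerCLM_apply] at h3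
  linarith

/-- Differentiating the relation `⟨f, g⟩ = c`. -/
theorem inner_fderiv_of_inner_eq_const {f g : E → F} {T : Set E} (hT : IsOpen T)
    (hf : ContDiffOn ℝ ∞ f T) (hg : ContDiffOn ℝ ∞ g T) {c : ℝ}
    (h : ∀ u ∈ T, inner ℝ (f u) (g u) = c) {u : E} (hu : u ∈ T) (w : E) :
    inner ℝ (fderiv ℝ f u w) (g u) + inner ℝ (f u) (fderiv ℝ g u w) = 0 := by
  have hdf := ((hf.contDiffAt (hT.mem_nhds hu)).differentiableAt (by simp)).hasFDerivAt
  have hdg := ((hg.contDiffAt (hT.mem_nhds hu)).differentiableAt (by simp)).hasFDerivAt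
  have h1 := hdf.inner ℝ hdg
  have h2 : HasFDerivAt (fun t => inner ℝ (f t) (g t)) (0 : E →L[ℝ] ℝ) u := by
    refine (hasFDerivAt_const c u).congr_of_eventuallyEq ?_
    filter_upwards [hT.mem_nhds hu] with t ht
    exact h t ht
  have h3 := congrArg (fun L => L w) (h1.unique h2)
  simp [fderivInnerCLM_apply] at h3
  linarith

theorem hasDerivAt_line (u w : E) (s : ℝ) : HasDerivAt (fun s : ℝ => u + s • w) w s := by
  simpa using ((hasDerivAt_id s).smul_const w).const_add u

theorem hasDerivAt_comp_line {f : E → F} {T : Set E} (hT : IsOpen T)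
    (hf : ContDiffOn ℝ ∞ f T) {u w : E} {s : ℝ} (hs : u + s • w ∈ T) :
    HasDerivAt (fun s : ℝ => f (u + s • w)) (fderiv ℝ f (u + s • w) w) s :=
  ((hf.contDiffAt (hT.mem_nhds hs)).differentiableAt (by simp)).hasFDerivAt.comp_hasDerivAt s
    (hasDerivAt_line u w s)

theorem hasDerivAt_fderiv_comp_line {f : E → F} {T : Set E} (hT : IsOpen T)
    (hf : ContDiffOn ℝ ∞ f T) {u w : E} {s : ℝ} (hs : u + s • w ∈ T) :
    HasDerivAt (fun s : ℝ => fderiv ℝ f (u + s • w) w)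
      (fderiv ℝ (fderiv ℝ f) (u + s • w) w w) s := by
  have hd : HasFDerivAt (fderiv ℝ f) (fderiv ℝ (fderiv ℝ f) (u + s • w)) (u + s • w) :=
    (((hf.contDiffAt (hT.mem_nhds hs)).fderiv_right (m := ∞) (by simp)).differentiableAt (by simp)).hasFDerivAt
  have h1 : HasDerivAt (fun s : ℝ => fderiv ℝ f (u + s • w)) _ s :=
    hd.comp_hasDerivAt s (hasDerivAt_line u w s)
  simpa using h1.clm_apply (hasDerivAt_const s w)

/-- Second derivative test, necessary condition. -/
theorem second_deriv_nonneg_of_isLocalMin {f f' : ℝ → ℝ} {f'' a : ℝ} (hmin : IsLocalMin f a)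
    (hf : ∀ᶠ s in 𝓝 a, HasDerivAt f (f' s) s) (hf' : HasDerivAt f' f'' a) : 0 ≤ f'' := by
  by_contra! hlt
  have hderiv : deriv f =ᶠ[𝓝 a] f' := hf.mono fun s hs => hs.deriv
  have h2 : deriv (deriv f) a = f'' := by rw [hderiv.deriv_eq, hf'.deriv]
  -- A negative second derivative makes `a` a local maximum as well, so `f` is locally constant and
  -- its second derivative vanishes.
  have hmax : IsLocalMax f a :=
    isLocalMax_of_deriv_deriv_neg (by rw [h2]; exact hlt) hmin.deriv_eq_zero
      hf.self_of_nhds.continuousAt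
  have hconst : f =ᶠ[𝓝 a] fun _ => f a := by
    filter_upwards [hmin, hmax] with s h1 h2 using le_antisymm h2 h1
  have h3 : deriv (deriv f) a = 0 := by
    have : deriv f =ᶠ[𝓝 a] fun _ => 0 := by
      simpa using hconst.deriv
    rw [this.deriv_eq]; simp
  linarith

/-- A function on `[0, 1]` vanishing to first order at `0`, with non-negative second derivative. -/
theorem nonneg_of_second_deriv_nonneg {f f' f'' : ℝ → ℝ}
    (hf : ∀ s ∈ Icc (0 : ℝ) 1, HasDerivAt f (f' s) s)
    (hf' : ∀ s ∈ Icc (0 : ℝ) 1, HasDerivAt f' (f'' s) s)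
    (h0 : f 0 = 0) (h0' : f' 0 = 0) (hnn : ∀ s ∈ Icc (0 : ℝ) 1, 0 ≤ f'' s) : 0 ≤ f 1 := by
  have m1 : MonotoneOn f' (Icc 0 1) := by
    refine monotoneOn_of_deriv_nonneg (convex_Icc 0 1)
      (fun s hs => (hf' s hs).continuousAt.continuousWithinAt)
      (fun s hs => (hf' s (interior_subset hs)).differentiableAt.differentiableWithinAt)
      (fun s hs => ?_)
    rw [(hf' s (interior_subset hs)).deriv]
    exact hnn s (interior_subset hs)
  have m2 : MonotoneOn f (Icc 0 1) := by
    refine monotoneOn_of_deriv_nonneg (convex_Icc 0 1)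
      (fun s hs => (hf s hs).continuousAt.continuousWithinAt)
      (fun s hs => (hf s (interior_subset hs)).differentiableAt.differentiableWithinAt)
      (fun s hs => ?_)
    rw [(hf s (interior_subset hs)).deriv, ← h0']
    exact m1 (by simp) (interior_subset hs) (interior_subset hs).1
  rw [← h0]
  exact m2 (by simp) (by simp) zero_le_one

end Calculus

/-! ### Surface patches: structure equations, variations, and the estimate near the diagonal. -/

/-- Coordinate expressions `X`, `N`, on an open subset `T` of the plane, of a surface in `S³` and of
its unit normal field. -/
structure IsSurfacePatch (X N : EuclideanSpace ℝ (Fin 2) → E4)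
    (T : Set (EuclideanSpace ℝ (Fin 2))) : Prop where
  isOpen : IsOpen T
  smooth_position : ContDiffOn ℝ ∞ X T
  smooth_normal : ContDiffOn ℝ ∞ N T
  norm_position : ∀ u ∈ T, ‖X u‖ = 1
  norm_normal : ∀ u ∈ T, ‖N u‖ = 1
  inner_position_normal : ∀ u ∈ T, inner ℝ (X u) (N u) = 0
  inner_tangent_normal : ∀ u ∈ T, ∀ w, inner ℝ (fderiv ℝ X u w) (N u) = 0

namespace IsSurfacePatch

open Filter Topology

variable {X N Y K : EuclideanSpace ℝ (Fin 2) → E4} {T S : Set (EuclideanSpace ℝ (Fin 2))}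
  {u v : EuclideanSpace ℝ (Fin 2)}

theorem inner_tangent_position (h : IsSurfacePatch X N T) (hu : u ∈ T)
    (w : EuclideanSpace ℝ (Fin 2)) : inner ℝ (fderiv ℝ X u w) (X u) = 0 := by
  have := inner_fderiv_of_inner_eq_const h.isOpen h.smooth_position h.smooth_position (c := 1)
    (fun u hu => by rw [real_inner_self_eq_norm_sq, h.norm_position u hu]; norm_num) hu w
  rw [real_inner_comm (X u)] at this
  rw [real_inner_comm]
  linarith

theorem inner_fderiv_normal_normal (h : IsSurfacePatch X N T) (hu : u ∈ T)
    (w : EuclideanSpace ℝ (Fin 2)) : inner ℝ (fderiv ℝ N u w) (N u) = 0 := by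
  have := inner_fderiv_of_inner_eq_const h.isOpen h.smooth_normal h.smooth_normal (c := 1)
    (fun u hu => by rw [real_inner_self_eq_norm_sq, h.norm_normal u hu]; norm_num) hu w
  rw [real_inner_comm (N u)] at this
  rw [real_inner_comm]
  linarith

theorem inner_fderiv_normal_position (h : IsSurfacePatch X N T) (hu : u ∈ T)
    (w : EuclideanSpace ℝ (Fin 2)) : inner ℝ (fderiv ℝ N u w) (X u) = 0 := by
  have := inner_fderiv_of_inner_eq_const h.isOpen h.smooth_position h.smooth_normal
    h.inner_position_normal hu w
  rw [h.inner_tangent_normal u hu w] at this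
  rw [real_inner_comm]
  linarith

/-- This and the three lemmas that follow express the components of second derivatives along `X` and
`N` by first derivatives. No tangential components, hence no Christoffel symbols, enter the second
variation at a touching pair. -/
theorem inner_second_position_position (h : IsSurfacePatch X N T) (hu : u ∈ T)
    (v w : EuclideanSpace ℝ (Fin 2)) :
    inner ℝ (fderiv ℝ (fderiv ℝ X) u v w) (X u) = -inner ℝ (fderiv ℝ X u w) (fderiv ℝ X u v) :=
  inner_fderiv_fderiv_of_orthogonal h.isOpen h.smooth_position h.smooth_position
    (fun _ hu w => h.inner_tangent_position hu w) hu v w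

theorem inner_second_position_normal (h : IsSurfacePatch X N T) (hu : u ∈ T)
    (v w : EuclideanSpace ℝ (Fin 2)) :
    inner ℝ (fderiv ℝ (fderiv ℝ X) u v w) (N u) = -inner ℝ (fderiv ℝ X u w) (fderiv ℝ N u v) :=
  inner_fderiv_fderiv_of_orthogonal h.isOpen h.smooth_position h.smooth_normal
    h.inner_tangent_normal hu v w

theorem inner_second_normal_position (h : IsSurfacePatch X N T) (hu : u ∈ T)
    (v w : EuclideanSpace ℝ (Fin 2)) :
    inner ℝ (fderiv ℝ (fderiv ℝ N) u v w) (X u) = -inner ℝ (fderiv ℝ N u w) (fderiv ℝ X u v) :=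
  inner_fderiv_fderiv_of_orthogonal h.isOpen h.smooth_normal h.smooth_position
    (fun _ hu w => h.inner_fderiv_normal_position hu w) hu v w

theorem inner_second_normal_normal (h : IsSurfacePatch X N T) (hu : u ∈ T)
    (v w : EuclideanSpace ℝ (Fin 2)) :
    inner ℝ (fderiv ℝ (fderiv ℝ N) u v w) (N u) = -inner ℝ (fderiv ℝ N u w) (fderiv ℝ N u v) :=
  inner_fderiv_fderiv_of_orthogonal h.isOpen h.smooth_normal h.smooth_normal
    (fun _ hu w => h.inner_fderiv_normal_normal hu w) hu v w

/-- Symmetry of the second fundamental form. -/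
theorem inner_fderiv_symm (h : IsSurfacePatch X N T) (hu : u ∈ T)
    (v w : EuclideanSpace ℝ (Fin 2)) :
    inner ℝ (fderiv ℝ X u w) (fderiv ℝ N u v) = inner ℝ (fderiv ℝ X u v) (fderiv ℝ N u w) := by
  have hs : IsSymmSndFDerivAt ℝ X u :=
    (h.smooth_position.contDiffAt (h.isOpen.mem_nhds hu)).isSymmSndFDerivAt
      (by simpa using WithTop.coe_le_coe.2 (le_top : (2 : ℕ∞) ≤ ⊤))
  have h1 := h.inner_second_position_normal hu v w
  have h2 := h.inner_second_position_normal hu w v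
  rw [hs v w] at h1
  linarith

/-- First and second variation of `Φ (1 - ⟨X, Y⟩) - ⟨N, Y⟩` at a minimum. -/
theorem variation (h : IsSurfacePatch X N T) (k : IsSurfacePatch Y K S) (hu : u ∈ T) (hv : v ∈ S)
    {Φ : ℝ} (h0 : Φ * (1 - inner ℝ (X u) (Y v)) - inner ℝ (N u) (Y v) = 0)
    (hnn : ∀ᶠ p : EuclideanSpace ℝ (Fin 2) × EuclideanSpace ℝ (Fin 2) in 𝓝 (u, v),
      0 ≤ Φ * (1 - inner ℝ (X p.1) (Y p.2)) - inner ℝ (N p.1) (Y p.2))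
    (a b : EuclideanSpace ℝ (Fin 2)) :
    Φ * inner ℝ (fderiv ℝ X u a) (Y v) + inner ℝ (fderiv ℝ N u a) (Y v)
      + Φ * inner ℝ (X u) (fderiv ℝ Y v b) + inner ℝ (N u) (fderiv ℝ Y v b) = 0 ∧
    0 ≤ -(Φ * (inner ℝ (fderiv ℝ (fderiv ℝ X) u a a) (Y v)
        + 2 * inner ℝ (fderiv ℝ X u a) (fderiv ℝ Y v b)
        + inner ℝ (X u) (fderiv ℝ (fderiv ℝ Y) v b b)))
      - (inner ℝ (fderiv ℝ (fderiv ℝ N) u a a) (Y v)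
        + 2 * inner ℝ (fderiv ℝ N u a) (fderiv ℝ Y v b)
        + inner ℝ (N u) (fderiv ℝ (fderiv ℝ Y) v b b)) := by
  set x := fun s : ℝ => X (u + s • a)
  set n := fun s : ℝ => N (u + s • a)
  set y := fun s : ℝ => Y (v + s • b)
  set x' := fun s : ℝ => fderiv ℝ X (u + s • a) a
  set n' := fun s : ℝ => fderiv ℝ N (u + s • a) a
  set y' := fun s : ℝ => fderiv ℝ Y (v + s • b) b
  have cu : Tendsto (fun s : ℝ => u + s • a) (𝓝 0) (𝓝 u) := by
    simpa using (hasDerivAt_line u a 0).continuousAt.tendsto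
  have cv : Tendsto (fun s : ℝ => v + s • b) (𝓝 0) (𝓝 v) := by
    simpa using (hasDerivAt_line v b 0).continuousAt.tendsto
  have hT : ∀ᶠ s : ℝ in 𝓝 0, u + s • a ∈ T := cu (h.isOpen.mem_nhds hu)
  have hS : ∀ᶠ s : ℝ in 𝓝 0, v + s • b ∈ S := cv (k.isOpen.mem_nhds hv)
  have hf : ∀ᶠ s in 𝓝 0, HasDerivAt
      (fun s => Φ * (1 - inner ℝ (x s) (y s)) - inner ℝ (n s) (y s))
      (Φ * (-(inner ℝ (x s) (y' s) + inner ℝ (x' s) (y s)))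
        - (inner ℝ (n s) (y' s) + inner ℝ (n' s) (y s))) s := by
    filter_upwards [hT, hS] with s h1 h2
    have dx : HasDerivAt x (x' s) s := hasDerivAt_comp_line h.isOpen h.smooth_position h1
    have dn : HasDerivAt n (n' s) s := hasDerivAt_comp_line h.isOpen h.smooth_normal h1
    have dy : HasDerivAt y (y' s) s := hasDerivAt_comp_line k.isOpen k.smooth_position h2
    exact (((dx.inner ℝ dy).const_sub 1).const_mul Φ).sub (dn.inner ℝ dy)
  have dx : HasDerivAt x (x' 0) 0 :=
    hasDerivAt_comp_line h.isOpen h.smooth_position hT.self_of_nhds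
  have dn : HasDerivAt n (n' 0) 0 :=
    hasDerivAt_comp_line h.isOpen h.smooth_normal hT.self_of_nhds
  have dy : HasDerivAt y (y' 0) 0 :=
    hasDerivAt_comp_line k.isOpen k.smooth_position hS.self_of_nhds
  have dx' : HasDerivAt x' _ 0 :=
    hasDerivAt_fderiv_comp_line h.isOpen h.smooth_position hT.self_of_nhds
  have dn' : HasDerivAt n' _ 0 :=
    hasDerivAt_fderiv_comp_line h.isOpen h.smooth_normal hT.self_of_nhds
  have dy' : HasDerivAt y' _ 0 :=
    hasDerivAt_fderiv_comp_line k.isOpen k.smooth_position hS.self_of_nhds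
  have hf' := ((((dx.inner ℝ dy').add (dx'.inner ℝ dy)).neg).const_mul Φ).sub
    ((dn.inner ℝ dy').add (dn'.inner ℝ dy))
  have hmin : IsLocalMin (fun s => Φ * (1 - inner ℝ (x s) (y s)) - inner ℝ (n s) (y s)) 0 := by
    have : Tendsto (fun s : ℝ => (u + s • a, v + s • b)) (𝓝 0) (𝓝 (u, v)) := cu.prodMk_nhds cv
    filter_upwards [this.eventually hnn] with s hs
    simp only [x, y, n, zero_smul, add_zero, h0]
    exact hs
  constructor
  · have := hmin.hasDerivAt_eq_zero hf.self_of_nhds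
    simp only [x, y, n, x', y', n', zero_smul, add_zero] at this
    linarith
  · have := second_deriv_nonneg_of_isLocalMin hmin hf hf'
    simp only [x, y, n, x', y', n', zero_smul, add_zero] at this
    linarith

/-- Near a point where the second fundamental form is less than `Φ` times the first one, the surface
does not meet the interior of the balls that touch it from the side of `N` and have geodesic radius
`arccot Φ`. -/
theorem eventually_nonneg (h : IsSurfacePatch X N T) (hu : u ∈ T) {Φ : ℝ}
    (hΦ : ∀ w, w ≠ 0 →
      0 < Φ * inner ℝ (fderiv ℝ X u w) (fderiv ℝ X u w)
        + inner ℝ (fderiv ℝ X u w) (fderiv ℝ N u w)) :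
    ∀ᶠ p : EuclideanSpace ℝ (Fin 2) × EuclideanSpace ℝ (Fin 2) in 𝓝 (u, u),
      0 ≤ Φ * (1 - inner ℝ (X p.1) (X p.2)) - inner ℝ (N p.1) (X p.2) := by
  have hTn := h.isOpen.mem_nhds hu
  have cX : ContinuousAt X u := (h.smooth_position.contDiffAt hTn).continuousAt
  have cN : ContinuousAt N u := (h.smooth_normal.contDiffAt hTn).continuousAt
  have cD : ContinuousAt (fderiv ℝ (fderiv ℝ X)) u :=
    (((h.smooth_position.contDiffAt hTn).fderiv_right (m := ∞) (by simp)).fderiv_right (m := 0) (by simp)).continuousAt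
  -- The form is minus the Hessian of `⟨Φ X p + N p, X ·⟩`. At `(u, u)` it equals the form in `hΦ`;
  -- compactness of the unit circle makes its positivity persist for nearby pairs of points,
  -- uniformly in the direction.
  have key : ∀ᶠ p : EuclideanSpace ℝ (Fin 2) × EuclideanSpace ℝ (Fin 2) in 𝓝 (u, u),
      ∀ w ∈ Metric.sphere (0 : EuclideanSpace ℝ (Fin 2)) 1,
        0 < -inner ℝ (Φ • X p.1 + N p.1) (fderiv ℝ (fderiv ℝ X) p.2 w w) := by
    refine (isCompact_sphere _ _).eventually_forall_of_forall_eventually fun w hw => ?_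
    have hc : ContinuousAt (fun z : (EuclideanSpace ℝ (Fin 2) × EuclideanSpace ℝ (Fin 2)) ×
        EuclideanSpace ℝ (Fin 2) => -inner ℝ (Φ • X z.1.1 + N z.1.1)
          (fderiv ℝ (fderiv ℝ X) z.1.2 z.2 z.2)) ((u, u), w) := by
      have c1 : ContinuousAt (fun z : (EuclideanSpace ℝ (Fin 2) × EuclideanSpace ℝ (Fin 2)) ×
        EuclideanSpace ℝ (Fin 2) => X z.1.1) ((u, u), w) :=
        ContinuousAt.comp (g := X) cX (by fun_prop)
      have c2 : ContinuousAt (fun z : (EuclideanSpace ℝ (Fin 2) × EuclideanSpace ℝ (Fin 2)) ×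
        EuclideanSpace ℝ (Fin 2) => N z.1.1) ((u, u), w) :=
        ContinuousAt.comp (g := N) cN (by fun_prop)
      have c3 : ContinuousAt (fun z : (EuclideanSpace ℝ (Fin 2) × EuclideanSpace ℝ (Fin 2)) ×
        EuclideanSpace ℝ (Fin 2) => fderiv ℝ (fderiv ℝ X) z.1.2) ((u, u), w) :=
        ContinuousAt.comp (g := fderiv ℝ (fderiv ℝ X)) cD (by fun_prop)
      have c4 : ContinuousAt (fun z : (EuclideanSpace ℝ (Fin 2) × EuclideanSpace ℝ (Fin 2)) ×
        EuclideanSpace ℝ (Fin 2) => z.2) ((u, u), w) := by fun_prop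
      exact (((c1.const_smul Φ).add c2).inner ((c3.clm_apply c4).clm_apply c4)).neg
    refine hc.eventually (lt_mem_nhds ?_)
    have hw0 : w ≠ 0 := by
      rintro rfl
      simp at hw
    have h1 := hΦ w hw0
    have h2 := h.inner_second_position_position hu w w
    have h3 := h.inner_second_position_normal hu w w
    simp only [inner_add_left, real_inner_smul_left]
    rw [real_inner_comm (X u)] at h2
    rw [real_inner_comm (N u)] at h3
    rw [h2, h3]
    linarith
  have hT2 : ∀ᶠ p : EuclideanSpace ℝ (Fin 2) × EuclideanSpace ℝ (Fin 2) in 𝓝 (u, u),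
      p.1 ∈ T ∧ p.2 ∈ T := by
    rw [nhds_prod_eq]
    exact (Filter.eventually_of_mem hTn fun _ h => h).prod_mk
      (Filter.eventually_of_mem hTn fun _ h => h)
  obtain ⟨r, hr, hball⟩ := Metric.eventually_nhds_iff_ball.1 (key.and hT2)
  refine Metric.eventually_nhds_iff_ball.2 ⟨r, hr, ?_⟩
  rintro ⟨p, q⟩ hpq
  rw [← ball_prod_same] at hpq hball
  have hseg : ∀ s ∈ Icc (0 : ℝ) 1, p + s • (q - p) ∈ Metric.ball u r := fun s hs => by
    have := (convex_ball u r).add_smul_sub_mem hpq.1 hpq.2 hs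
    exact this
  have hsT : ∀ s ∈ Icc (0 : ℝ) 1, p + s • (q - p) ∈ T := fun s hs =>
    (hball (p, p + s • (q - p)) ⟨hpq.1, hseg s hs⟩).2.2
  have hpT : p ∈ T := (hball (p, q) hpq).2.1
  -- Along the segment from `p` to `q` the function vanishes to first order at `p`, since `X p`, `N
  -- p` are orthonormal and normal to the tangent plane there; convexity gives the sign at `q`.
  have main := nonneg_of_second_deriv_nonneg
    (f := fun s => Φ - inner ℝ (Φ • X p + N p) (X (p + s • (q - p))))
    (f' := fun s => -inner ℝ (Φ • X p + N p) (fderiv ℝ X (p + s • (q - p)) (q - p)))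
    (f'' := fun s =>
      -inner ℝ (Φ • X p + N p) (fderiv ℝ (fderiv ℝ X) (p + s • (q - p)) (q - p) (q - p)))
    (fun s hs => by
      have := (hasDerivAt_const s (Φ • X p + N p)).inner ℝ
        (hasDerivAt_comp_line h.isOpen h.smooth_position (hsT s hs))
      simpa using this.const_sub Φ)
    (fun s hs => by
      have := (hasDerivAt_const s (Φ • X p + N p)).inner ℝ
        (hasDerivAt_fderiv_comp_line h.isOpen h.smooth_position (hsT s hs))
      rw [inner_zero_left, add_zero] at this
      exact this.neg)
    (by
      have h1 := h.norm_position p hpT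
      have h2 := h.inner_position_normal p hpT
      simp [inner_add_left, real_inner_smul_left, h1, real_inner_comm (X p) (N p), h2])
    (by
      have h1 := h.inner_tangent_position hpT (q - p)
      have h2 := h.inner_tangent_normal p hpT (q - p)
      rw [real_inner_comm] at h1 h2
      simp only [zero_smul, add_zero, inner_add_left, real_inner_smul_left, h1, h2]
      simp)
    (fun s hs => by
      rcases eq_or_ne (q - p) 0 with h0 | h0
      · simp [h0]
      · have hn : ‖q - p‖ ≠ 0 := norm_ne_zero_iff.2 h0
        have := (hball (p, p + s • (q - p)) ⟨hpq.1, hseg s hs⟩).1 (‖q - p‖⁻¹ • (q - p))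
          (by simp [norm_smul, hn])
        simp only [map_smul, smul_apply, real_inner_smul_right] at this
        have h3 : 0 < ‖q - p‖⁻¹ * ‖q - p‖⁻¹ := by positivity
        have h4 : 0 < (‖q - p‖⁻¹ * ‖q - p‖⁻¹) * -inner ℝ (Φ • X p + N p)
          (fderiv ℝ (fderiv ℝ X) (p + s • (q - p)) (q - p) (q - p)) := by linarith
        exact (pos_of_mul_pos_right h4 h3.le).le)
  simp only [one_smul, add_sub_cancel, inner_add_left, real_inner_smul_left] at main
  linarith

end IsSurfacePatch

end

/-! ### Adapted frames and the two-point maximum principle. -/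

noncomputable section

/-- Expansion of a vector of `ℝ⁴` in an orthonormal basis. -/
theorem eq_sum_of_orthonormal {b : Fin 4 → E4} (hb : Orthonormal ℝ b) (v : E4) :
    v = ∑ i, inner ℝ (b i) v • b i := by
  have hspan : ⊤ ≤ Submodule.span ℝ (Set.range b) := by
    rw [hb.linearIndependent.span_eq_top_of_card_eq_finrank (by simp)]
  have h := (OrthonormalBasis.mk hb hspan).sum_repr' v
  simpa using h.symm

/-- An injective linear map from the plane has an orthonormal basis of its image. -/
theorem exists_orthonormal_image (P : EuclideanSpace ℝ (Fin 2) →L[ℝ] E4)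
    (hP : Function.Injective P) :
    ∃ e : Fin 2 → EuclideanSpace ℝ (Fin 2), Orthonormal ℝ (fun i => P (e i)) ∧
      ∀ w, w = inner ℝ (P (e 0)) (P w) • e 0 + inner ℝ (P (e 1)) (P w) • e 1 := by
  let R := LinearMap.range (P : EuclideanSpace ℝ (Fin 2) →ₗ[ℝ] E4)
  have hfin : Module.finrank ℝ R = 2 := by
    rw [LinearMap.finrank_range_of_inj hP]; simp
  let b : OrthonormalBasis (Fin 2) ℝ R := (stdOrthonormalBasis ℝ R).reindex (finCongr hfin)
  have hmem : ∀ i, ∃ e, P e = b i := fun i => (b i).2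
  choose e he using hmem
  refine ⟨e, ?_, fun w => hP ?_⟩
  · simp only [he]
    exact b.orthonormal.comp_linearIsometry R.subtypeₗᵢ
  · have h := congrArg (Subtype.val : R → E4) (b.sum_repr' ⟨P w, w, rfl⟩)
    simp only [Fin.sum_univ_two, Submodule.coe_add, Submodule.coe_smul, Submodule.coe_inner] at h
    simp only [map_add, map_smul, he]
    exact h.symm

theorem orthonormal_four {a b c d : E4} (ha : ‖a‖ = 1) (hb : ‖b‖ = 1) (hab : inner ℝ a b = 0)
    {e : Fin 2 → E4} (he : Orthonormal ℝ e) (hc : e 0 = c) (hd : e 1 = d)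
    (h1 : ∀ i, inner ℝ (e i) a = 0) (h2 : ∀ i, inner ℝ (e i) b = 0) :
    Orthonormal ℝ ![a, b, c, d] := by
  have n0 := he.1 0
  have n1 := he.1 1
  have i01 := he.2 (show (0 : Fin 2) ≠ 1 by decide)
  have a0 := h1 0
  have a1 := h1 1
  have b0 := h2 0
  have b1 := h2 1
  rw [hc] at n0 i01 a0 b0
  rw [hd] at n1 i01 a1 b1
  have a0' := (real_inner_comm _ _).trans a0
  have a1' := (real_inner_comm _ _).trans a1
  have b0' := (real_inner_comm _ _).trans b0
  have b1' := (real_inner_comm _ _).trans b1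
  have hab' := (real_inner_comm _ _).trans hab
  have i10 := (real_inner_comm _ _).trans i01
  constructor
  · intro i
    fin_cases i <;> simp [*]
  · intro i j hij
    fin_cases i <;> fin_cases j <;> first | exact absurd rfl hij | simpa

namespace IsSurfacePatch

variable {X N Y K : EuclideanSpace ℝ (Fin 2) → E4} {T S : Set (EuclideanSpace ℝ (Fin 2))}
  {u v : EuclideanSpace ℝ (Fin 2)}

theorem eq_expansion (h : IsSurfacePatch X N T) (hu : u ∈ T)
    {e : Fin 2 → EuclideanSpace ℝ (Fin 2)} (he : Orthonormal ℝ (fun i => fderiv ℝ X u (e i)))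
    (z : E4) :
    z = inner ℝ (X u) z • X u + inner ℝ (N u) z • N u
      + inner ℝ (fderiv ℝ X u (e 0)) z • fderiv ℝ X u (e 0)
      + inner ℝ (fderiv ℝ X u (e 1)) z • fderiv ℝ X u (e 1) := by
  have := eq_sum_of_orthonormal (orthonormal_four (h.norm_position u hu) (h.norm_normal u hu)
    (h.inner_position_normal u hu) he rfl rfl (fun i => h.inner_tangent_position hu _)
    (fun i => h.inner_tangent_normal u hu _)) z
  simpa [Fin.sum_univ_four] using this

/-- The Weingarten equations of a minimal surface. -/
theorem weingarten (h : IsSurfacePatch X N T) (hu : u ∈ T)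
    {e : Fin 2 → EuclideanSpace ℝ (Fin 2)} (he : Orthonormal ℝ (fun i => fderiv ℝ X u (e i)))
    (hmin : ∑ i, inner ℝ (fderiv ℝ X u (e i)) (fderiv ℝ N u (e i)) = 0) :
    ∃ p q : ℝ, fderiv ℝ N u (e 0) = -p • fderiv ℝ X u (e 0) - q • fderiv ℝ X u (e 1) ∧
      fderiv ℝ N u (e 1) = -q • fderiv ℝ X u (e 0) + p • fderiv ℝ X u (e 1) := by
  -- The matrix of the second fundamental form is `(p q; q -p)`: symmetry identifies its
  -- off-diagonal entries and minimality its diagonal ones up to sign.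
  refine ⟨-inner ℝ (fderiv ℝ X u (e 0)) (fderiv ℝ N u (e 0)),
    -inner ℝ (fderiv ℝ X u (e 0)) (fderiv ℝ N u (e 1)), ?_, ?_⟩
  · have h1 := h.eq_expansion hu he (fderiv ℝ N u (e 0))
    rw [real_inner_comm _ (X u), h.inner_fderiv_normal_position hu, real_inner_comm _ (N u),
      h.inner_fderiv_normal_normal hu, h.inner_fderiv_symm hu (e 0) (e 1)] at h1
    exact h1.trans (by module)
  · have h1 := h.eq_expansion hu he (fderiv ℝ N u (e 1))
    rw [Fin.sum_univ_two] at hmin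
    rw [real_inner_comm _ (X u), h.inner_fderiv_normal_position hu, real_inner_comm _ (N u),
      h.inner_fderiv_normal_normal hu, eq_neg_of_add_eq_zero_right hmin] at h1
    exact h1.trans (by module)

/-- The quantity is the determinant of `Φ - A`, where `A = (p q; q -p)` is the shape operator, and
`Φ - A` is positive definite by `hΦ`. -/
theorem pos_discriminant {e : Fin 2 → EuclideanSpace ℝ (Fin 2)}
    (he : Orthonormal ℝ (fun i => fderiv ℝ X u (e i))) {p q Φ : ℝ}
    (hp : fderiv ℝ N u (e 0) = -p • fderiv ℝ X u (e 0) - q • fderiv ℝ X u (e 1))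
    (hq : fderiv ℝ N u (e 1) = -q • fderiv ℝ X u (e 0) + p • fderiv ℝ X u (e 1))
    (hΦ : ∀ w, w ≠ 0 → 0 < Φ * inner ℝ (fderiv ℝ X u w) (fderiv ℝ X u w)
      + inner ℝ (fderiv ℝ X u w) (fderiv ℝ N u w)) : 0 < Φ ^ 2 - p ^ 2 - q ^ 2 := by
  have i00 : inner ℝ (fderiv ℝ X u (e 0)) (fderiv ℝ X u (e 0)) = 1 := by
    rw [real_inner_self_eq_norm_sq, he.1 0]; norm_num
  have i11 : inner ℝ (fderiv ℝ X u (e 1)) (fderiv ℝ X u (e 1)) = 1 := by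
    rw [real_inner_self_eq_norm_sq, he.1 1]; norm_num
  have i01 : inner ℝ (fderiv ℝ X u (e 0)) (fderiv ℝ X u (e 1)) = 0 := he.2 (by decide)
  have i10 : inner ℝ (fderiv ℝ X u (e 1)) (fderiv ℝ X u (e 0)) = 0 := he.2 (by decide)
  have ne0 : ∀ a b : ℝ, b ≠ 0 → a • e 0 + b • e 1 ≠ 0 := by
    intro a b hb h0
    have h1 := congrArg (fun w => inner ℝ (fderiv ℝ X u (e 1)) (fderiv ℝ X u w)) h0
    simp [inner_add_right, real_inner_smul_right, i10] at h1
    exact h1.elim hb fun h => he.ne_zero 1 (by simpa using h)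
  have h0 : e 0 ≠ 0 := by
    intro h0
    simp [h0] at i00
  have h1 := hΦ _ h0
  rw [hp, inner_sub_right, real_inner_smul_right, real_inner_smul_right, i00, i01] at h1
  -- The test vector is the second column of the adjugate of `Φ - A`, so the form takes the value
  -- `(Φ - p) * det (Φ - A)` on it.
  have h2 := hΦ _ (ne0 q (Φ - p) (by linarith))
  simp only [map_add, map_smul, hp, hq, inner_add_left, inner_add_right, inner_sub_right,
    real_inner_smul_left, real_inner_smul_right, i00, i01, i10, i11] at h2
  have h3 : 0 < (Φ - p) * (Φ ^ 2 - p ^ 2 - q ^ 2) := by nlinarith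
  exact pos_of_mul_pos_right h3 (by linarith)

/-- The two-point maximum principle: a ball of geodesic radius `arccot Φ ≤ π / 4` that touches a
minimal surface at one point, where its principal curvatures are less than `Φ`, cannot touch it
from inside at a second point. -/
theorem position_eq_of_touching (h : IsSurfacePatch X N T) (k : IsSurfacePatch Y K S)
    (hu : u ∈ T) (hv : v ∈ S) (iX : Function.Injective (fderiv ℝ X u))
    (iY : Function.Injective (fderiv ℝ Y v))
    (mX : ∀ e : Fin 2 → EuclideanSpace ℝ (Fin 2), Orthonormal ℝ (fun i => fderiv ℝ X u (e i)) →
      ∑ i, inner ℝ (fderiv ℝ X u (e i)) (fderiv ℝ N u (e i)) = 0)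
    (mY : ∀ e : Fin 2 → EuclideanSpace ℝ (Fin 2), Orthonormal ℝ (fun i => fderiv ℝ Y v (e i)) →
      ∑ i, inner ℝ (fderiv ℝ Y v (e i)) (fderiv ℝ K v (e i)) = 0)
    {Φ : ℝ} (hΦ1 : 1 ≤ Φ)
    (hΦ : ∀ w, w ≠ 0 → 0 < Φ * inner ℝ (fderiv ℝ X u w) (fderiv ℝ X u w)
      + inner ℝ (fderiv ℝ X u w) (fderiv ℝ N u w))
    (h0 : Φ * (1 - inner ℝ (X u) (Y v)) - inner ℝ (N u) (Y v) = 0)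
    (hnn : ∀ᶠ p : EuclideanSpace ℝ (Fin 2) × EuclideanSpace ℝ (Fin 2) in nhds (u, v),
      0 ≤ Φ * (1 - inner ℝ (X p.1) (Y p.2)) - inner ℝ (N p.1) (Y p.2)) :
    X u = Y v := by
  by_contra hne
  obtain ⟨e, he, -⟩ := exists_orthonormal_image _ iX
  obtain ⟨p, q, hp, hq⟩ := h.weingarten hu he (mX e he)
  have hD := pos_discriminant he hp hq hΦ
  have hvar := h.variation k hu hv h0 hnn
  have i00 : inner ℝ (fderiv ℝ X u (e 0)) (fderiv ℝ X u (e 0)) = 1 := by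
    rw [real_inner_self_eq_norm_sq, he.1 0]; norm_num
  have i11 : inner ℝ (fderiv ℝ X u (e 1)) (fderiv ℝ X u (e 1)) = 1 := by
    rw [real_inner_self_eq_norm_sq, he.1 1]; norm_num
  have i01 : inner ℝ (fderiv ℝ X u (e 0)) (fderiv ℝ X u (e 1)) = 0 := he.2 (by decide)
  have i10 : inner ℝ (fderiv ℝ X u (e 1)) (fderiv ℝ X u (e 0)) = 0 := he.2 (by decide)
  have nX : inner ℝ (X u) (X u) = 1 := by
    rw [real_inner_self_eq_norm_sq, h.norm_position u hu]; norm_num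
  have nY : inner ℝ (Y v) (Y v) = 1 := by
    rw [real_inner_self_eq_norm_sq, k.norm_position v hv]; norm_num
  have nN : inner ℝ (N u) (N u) = 1 := by
    rw [real_inner_self_eq_norm_sq, h.norm_normal u hu]; norm_num
  have iXN := h.inner_position_normal u hu
  -- `Y v` lies in the plane spanned by `X u` and `N u`
  have z0 : inner ℝ (fderiv ℝ X u (e 0)) (Y v) = 0 := by
    have a0 := (hvar (e 0) 0).1
    have a1 := (hvar (e 1) 0).1
    simp only [map_zero, inner_zero_right, mul_zero, add_zero, hp, hq, inner_add_left,
      inner_sub_left, real_inner_smul_left] at a0 a1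
    have : (Φ ^ 2 - p ^ 2 - q ^ 2) * inner ℝ (fderiv ℝ X u (e 0)) (Y v) = 0 := by
      -- The first variation reads `(Φ - A) z = 0` for the tangential part `z` of `Y v`; the
      -- coefficients are a row of the adjugate of `Φ - A`.
      linear_combination (Φ + p) * a0 + q * a1
    exact (mul_eq_zero.1 this).resolve_left hD.ne'
  have z1 : inner ℝ (fderiv ℝ X u (e 1)) (Y v) = 0 := by
    have a0 := (hvar (e 0) 0).1
    have a1 := (hvar (e 1) 0).1
    simp only [map_zero, inner_zero_right, mul_zero, add_zero, hp, hq, inner_add_left,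
      inner_sub_left, real_inner_smul_left] at a0 a1
    have : (Φ ^ 2 - p ^ 2 - q ^ 2) * inner ℝ (fderiv ℝ X u (e 1)) (Y v) = 0 := by
      linear_combination q * a0 + (Φ - p) * a1
    exact (mul_eq_zero.1 this).resolve_left hD.ne'
  obtain ⟨a, ha⟩ : ∃ a, inner ℝ (X u) (Y v) = a := ⟨_, rfl⟩
  obtain ⟨b, hb⟩ : ∃ b, inner ℝ (N u) (Y v) = b := ⟨_, rfl⟩
  have hY : Y v = a • X u + b • N u := by
    have := h.eq_expansion hu he (Y v)
    rwa [z0, z1, zero_smul, zero_smul, add_zero, add_zero, ha, hb] at this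
  rw [ha, hb] at h0
  have hab : a ^ 2 + b ^ 2 = 1 := by
    have := nY
    rw [hY] at this
    simp only [inner_add_left, inner_add_right, real_inner_smul_left, real_inner_smul_right,
      nX, nN, iXN, real_inner_comm (X u) (N u)] at this
    linarith
  have ha1 : 0 < 1 - a := by
    rcases eq_or_ne a 1 with h1 | h1
    · exact absurd ((inner_eq_one_iff_of_norm_eq_one (h.norm_position u hu)
        (k.norm_position v hv)).1 (ha.trans h1)) hne
    · have : a ≤ 1 := by nlinarith
      have := lt_of_le_of_ne this h1
      linarith
  have hb' : b = Φ * (1 - a) := by linarith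
  have hΦa : Φ ^ 2 * (1 - a) = 1 + a := by
    have : (1 - a) * (Φ ^ 2 * (1 - a)) = (1 - a) * (1 + a) := by
      rw [hb'] at hab; linear_combination hab
    exact mul_left_cancel₀ ha1.ne' this
  -- Since `Φ ≥ 1`, `hΦa` gives `1 + a ≥ 1 - a`: the touching points are at spherical distance at
  -- most π/2.
  have ha0 : 0 ≤ a := by nlinarith
  -- the tangent planes at the two points coincide
  have tX : ∀ w, inner ℝ (X u) (fderiv ℝ Y v w) = 0 := fun w => by
    have a0 := (hvar 0 w).1
    have a1 := k.inner_tangent_position hv w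
    rw [real_inner_comm, hY] at a1
    simp only [map_zero, inner_zero_left, mul_zero, zero_add, inner_add_left,
      real_inner_smul_left] at a0 a1
    rw [hb'] at a1
    -- The components along `X u` and `N u` solve a homogeneous linear system whose determinant is,
    -- up to sign, `a - Φ ^ 2 * (1 - a) = -1`.
    linear_combination Φ * (1 - a) * a0 - a1 + (-inner ℝ (X u) (fderiv ℝ Y v w)) * hΦa
  have tN : ∀ w, inner ℝ (N u) (fderiv ℝ Y v w) = 0 := fun w => by
    have a0 := (hvar 0 w).1
    simp only [map_zero, inner_zero_left, mul_zero, zero_add, tX] at a0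
    exact a0
  have hsurj : ∀ c d : ℝ, ∃ w, fderiv ℝ Y v w
      = c • fderiv ℝ X u (e 0) + d • fderiv ℝ X u (e 1) := by
    let L : EuclideanSpace ℝ (Fin 2) →ₗ[ℝ] ℝ × ℝ :=
      ((innerₛₗ ℝ (fderiv ℝ X u (e 0))).prod (innerₛₗ ℝ (fderiv ℝ X u (e 1)))).comp
        (fderiv ℝ Y v : EuclideanSpace ℝ (Fin 2) →ₗ[ℝ] E4)
    have hexp : ∀ w, fderiv ℝ Y v w = (L w).1 • fderiv ℝ X u (e 0)
        + (L w).2 • fderiv ℝ X u (e 1) := fun w => by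
      have := h.eq_expansion hu he (fderiv ℝ Y v w)
      rwa [tX, tN, zero_smul, zero_smul, add_zero, zero_add] at this
    have hinj : Function.Injective L := fun w₁ w₂ hw => iY (by rw [hexp, hexp, hw])
    have hL := (LinearMap.injective_iff_surjective_of_finrank_eq_finrank (f := L) (by simp)).1 hinj
    intro c d
    obtain ⟨w, hw⟩ := hL (c, d)
    exact ⟨w, by rw [hexp, hw]⟩
  obtain ⟨f₀, hf₀⟩ := hsurj 1 0
  obtain ⟨f₁, hf₁⟩ := hsurj 0 1
  simp only [one_smul, zero_smul, add_zero, zero_add] at hf₀ hf₁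
  have hf : (fun i => fderiv ℝ Y v (![f₀, f₁] i)) = fun i => fderiv ℝ X u (e i) := by
    funext i
    fin_cases i
    · exact hf₀
    · exact hf₁
  have hfo : Orthonormal ℝ (fun i => fderiv ℝ Y v (![f₀, f₁] i)) := hf ▸ he
  have mf := mY _ hfo
  simp only [Fin.sum_univ_two, Matrix.cons_val_zero, Matrix.cons_val_one] at mf
  -- `Φ X + N` in terms of the frame at the second point
  obtain ⟨β, hβ⟩ : ∃ β, Φ • X u + N u = Φ • Y v + β • K v := by
    refine ⟨inner ℝ (K v) (Φ • X u + N u), ?_⟩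
    have h1 := k.eq_expansion hv hfo (Φ • X u + N u)
    simp only [Matrix.cons_val_zero, Matrix.cons_val_one] at h1
    have h2 : inner ℝ (Y v) (Φ • X u + N u) = Φ := by
      rw [inner_add_right, real_inner_smul_right, real_inner_comm (X u), real_inner_comm (N u),
        ha, hb, hb']
      ring
    have h3 : ∀ w, inner ℝ (fderiv ℝ Y v w) (Φ • X u + N u) = 0 := fun w => by
      rw [inner_add_right, real_inner_smul_right, real_inner_comm (X u), real_inner_comm (N u),
        tX, tN]
      ring
    rwa [h2, h3, h3, zero_smul, zero_smul, add_zero, add_zero] at h1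
  -- The coefficient `β` is not controlled, but it multiplies the second fundamental form at `v`,
  -- whose trace vanishes.
  have sY : ∀ w, Φ * inner ℝ (X u) (fderiv ℝ (fderiv ℝ Y) v w w)
      + inner ℝ (N u) (fderiv ℝ (fderiv ℝ Y) v w w)
      = -Φ * inner ℝ (fderiv ℝ Y v w) (fderiv ℝ Y v w)
        - β * inner ℝ (fderiv ℝ Y v w) (fderiv ℝ K v w) := fun w => by
    have h1 := k.inner_second_position_position hv w w
    have h2 := k.inner_second_position_normal hv w w
    rw [← real_inner_smul_left, ← inner_add_left, hβ, inner_add_left, real_inner_smul_left,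
      real_inner_smul_left, real_inner_comm (fderiv ℝ (fderiv ℝ Y) v w w),
      real_inner_comm (fderiv ℝ (fderiv ℝ Y) v w w), h1, h2]
    ring
  have sX : ∀ w, inner ℝ (fderiv ℝ (fderiv ℝ X) u w w) (Y v)
      = -a * inner ℝ (fderiv ℝ X u w) (fderiv ℝ X u w)
        - b * inner ℝ (fderiv ℝ X u w) (fderiv ℝ N u w) := fun w => by
    rw [hY, inner_add_right, real_inner_smul_right, real_inner_smul_right,
      h.inner_second_position_position hu, h.inner_second_position_normal hu]
    ring
  have sN : ∀ w, inner ℝ (fderiv ℝ (fderiv ℝ N) u w w) (Y v)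
      = -a * inner ℝ (fderiv ℝ N u w) (fderiv ℝ X u w)
        - b * inner ℝ (fderiv ℝ N u w) (fderiv ℝ N u w) := fun w => by
    rw [hY, inner_add_right, real_inner_smul_right, real_inner_smul_right,
      h.inner_second_normal_position hu, h.inner_second_normal_normal hu]
    ring
  set D := Φ ^ 2 - p ^ 2 - q ^ 2 with hDdef
  -- The displacements at `u` are `Φ (Φ + A) eᵢ`. As `A² = p² + q²`, `Φ - A` maps them to `Φ D eᵢ`,
  -- so `D eᵢ` is the displacement at `v` minimizing `Φ |z|² - 2 ⟨(Φ - A) w, z⟩`. Being multiples of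
  -- an orthonormal frame, these displacements let the `β` terms cancel in the sum.
  have v0 := (hvar ((Φ * (Φ + p)) • e 0 + (Φ * q) • e 1) (D • f₀)).2
  have v1 := (hvar ((Φ * q) • e 0 + (Φ * (Φ - p)) • e 1) (D • f₁)).2
  have s0 := sY (D • f₀)
  have s1 := sY (D • f₁)
  rw [sX, sN] at v0 v1
  simp only [map_smul, map_add, hp, hq, hf₀, hf₁, inner_add_left, inner_add_right,
    inner_sub_left, inner_sub_right, real_inner_smul_left, real_inner_smul_right, i00, i01, i10,
    i11, smul_apply] at v0 v1 s0 s1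
  rw [hf₀, hf₁] at mf
  have hfinal : 0 ≤ 2 * Φ * D * (-(1 + a) - a * (p ^ 2 + q ^ 2)) := by
    clear_value D
    subst hDdef hb'
    linear_combination v0 + v1 - s0 - s1 + β * (Φ ^ 2 - p ^ 2 - q ^ 2) ^ 2 * mf
      - 2 * Φ * (Φ ^ 2 - p ^ 2 - q ^ 2) * (1 + p ^ 2 + q ^ 2) * hΦa
  have hneg : 0 < 2 * Φ * D * ((1 + a) + a * (p ^ 2 + q ^ 2)) := by positivity
  linarith

end IsSurfacePatch

end

/-! ### Principal curvatures of a traceless second fundamental form. -/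

noncomputable section

namespace IsSurfacePatch

variable {X N : EuclideanSpace ℝ (Fin 2) → E4} {T : Set (EuclideanSpace ℝ (Fin 2))}
  {u : EuclideanSpace ℝ (Fin 2)}

/-- A traceless second fundamental form has exactly one non-negative principal curvature, and this
is the maximum of the normal curvatures. -/
theorem exists_principalCurvature (h : IsSurfacePatch X N T) (hu : u ∈ T)
    (iX : Function.Injective (fderiv ℝ X u))
    (mX : ∀ e : Fin 2 → EuclideanSpace ℝ (Fin 2), Orthonormal ℝ (fun i => fderiv ℝ X u (e i)) →
      ∑ i, inner ℝ (fderiv ℝ X u (e i)) (fderiv ℝ N u (e i)) = 0) :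
    ∃ μ : ℝ, 0 ≤ μ ∧
      (∃ v, v ≠ 0 ∧ ∀ w, -inner ℝ (fderiv ℝ N u v) (fderiv ℝ X u w)
        = μ * inner ℝ (fderiv ℝ X u v) (fderiv ℝ X u w)) ∧
      (∀ κ, 0 ≤ κ → (∃ v, v ≠ 0 ∧ ∀ w, -inner ℝ (fderiv ℝ N u v) (fderiv ℝ X u w)
        = κ * inner ℝ (fderiv ℝ X u v) (fderiv ℝ X u w)) → κ = μ) ∧
      ∀ w, -inner ℝ (fderiv ℝ X u w) (fderiv ℝ N u w)
        ≤ μ * inner ℝ (fderiv ℝ X u w) (fderiv ℝ X u w) := by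
  obtain ⟨e, he, hspan⟩ := exists_orthonormal_image _ iX
  obtain ⟨p, q, hp, hq⟩ := h.weingarten hu he (mX e he)
  have i00 : inner ℝ (fderiv ℝ X u (e 0)) (fderiv ℝ X u (e 0)) = 1 := by
    rw [real_inner_self_eq_norm_sq, he.1 0]; norm_num
  have i11 : inner ℝ (fderiv ℝ X u (e 1)) (fderiv ℝ X u (e 1)) = 1 := by
    rw [real_inner_self_eq_norm_sq, he.1 1]; norm_num
  have i01 : inner ℝ (fderiv ℝ X u (e 0)) (fderiv ℝ X u (e 1)) = 0 := he.2 (by decide)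
  have i10 : inner ℝ (fderiv ℝ X u (e 1)) (fderiv ℝ X u (e 0)) = 0 := he.2 (by decide)
  have hpair : ∀ c d c' d' : ℝ,
      inner ℝ (fderiv ℝ X u (c • e 0 + d • e 1)) (fderiv ℝ X u (c' • e 0 + d' • e 1))
        = c * c' + d * d' := fun c d c' d' => by
    simp only [map_add, map_smul, inner_add_left, inner_add_right, real_inner_smul_left,
      real_inner_smul_right, i00, i01, i10, i11]
    ring
  have hpairN : ∀ c d c' d' : ℝ,
      inner ℝ (fderiv ℝ N u (c • e 0 + d • e 1)) (fderiv ℝ X u (c' • e 0 + d' • e 1))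
        = -((p * c + q * d) * c' + (q * c - p * d) * d') := fun c d c' d' => by
    simp only [map_add, map_smul, hp, hq, inner_add_left, inner_add_right, inner_sub_left,
      real_inner_smul_left, real_inner_smul_right, i00, i01, i10, i11]
    ring
  have hsq : √(p ^ 2 + q ^ 2) ^ 2 = p ^ 2 + q ^ 2 := sq_sqrt (by positivity)
  have hμ := sqrt_nonneg (p ^ 2 + q ^ 2)
  set μ := √(p ^ 2 + q ^ 2)
  have heig : ∀ c d : ℝ, p * c + q * d = μ * c → q * c - p * d = μ * d → ∀ w,
      -inner ℝ (fderiv ℝ N u (c • e 0 + d • e 1)) (fderiv ℝ X u w)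
        = μ * inner ℝ (fderiv ℝ X u (c • e 0 + d • e 1)) (fderiv ℝ X u w) := by
    intro c d h0 h1 w
    rw [hspan w, hpair, hpairN, h0, h1]
    ring
  have hne : ∀ c d : ℝ, c ^ 2 + d ^ 2 ≠ 0 → c • e 0 + d • e 1 ≠ 0 := by
    intro c d hcd h0
    have := hpair c d c d
    rw [h0] at this
    simp only [map_zero, inner_zero_left] at this
    exact hcd (by linarith)
  refine ⟨μ, hμ, ?_, ?_, ?_⟩
  -- The vector `(p + μ, q)` is an eigenvector for `μ` unless it vanishes; then `q = 0`, `p = -μ`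
  -- and `e 1` is one.
  · by_cases h0 : (p + μ) ^ 2 + q ^ 2 = 0
    · have hq0 : q = 0 := by nlinarith [sq_nonneg (p + μ), sq_nonneg q]
      have hp0 : p + μ = 0 := by nlinarith [sq_nonneg (p + μ), sq_nonneg q]
      refine ⟨(0 : ℝ) • e 0 + (1 : ℝ) • e 1, hne _ _ (by norm_num), heig _ _ ?_ ?_⟩
      · rw [hq0]; ring
      · linarith
    · refine ⟨(p + μ) • e 0 + q • e 1, hne _ _ h0, heig _ _ ?_ ?_⟩
      · linear_combination -hsq
      · ring
  · rintro κ hκ ⟨v, hv0, hv⟩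
    have hv' := hspan v
    set c := inner ℝ (fderiv ℝ X u (e 0)) (fderiv ℝ X u v)
    set d := inner ℝ (fderiv ℝ X u (e 1)) (fderiv ℝ X u v)
    have h0 := hv ((1 : ℝ) • e 0 + (0 : ℝ) • e 1)
    have h1 := hv ((0 : ℝ) • e 0 + (1 : ℝ) • e 1)
    rw [hv', hpair, hpairN] at h0 h1
    have hcd : c ^ 2 + d ^ 2 ≠ 0 := fun hcd => hv0 (by
      have hc : c = 0 := by nlinarith [sq_nonneg c, sq_nonneg d]
      have hd : d = 0 := by nlinarith [sq_nonneg c, sq_nonneg d]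
      rw [hv', hc, hd]; simp)
    -- The square of the shape operator is `μ ^ 2` times the identity.
    have h2 : (c ^ 2 + d ^ 2) * (κ ^ 2 - μ ^ 2) = 0 := by
      have a0 : p * c + q * d = κ * c := by linarith
      have a1 : q * c - p * d = κ * d := by linarith
      rw [hsq]
      linear_combination (-κ * c - (p * c + q * d)) * a0 + (-κ * d - (q * c - p * d)) * a1
    have h3 := (mul_eq_zero.1 h2).resolve_left hcd
    have h4 : (κ - μ) * (κ + μ) = 0 := by linarith
    rcases mul_eq_zero.1 h4 with h5 | h5 <;> linarith
  · intro w
    rw [real_inner_comm, hspan w, hpair, hpairN]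
    set c := inner ℝ (fderiv ℝ X u (e 0)) (fderiv ℝ X u w)
    set d := inner ℝ (fderiv ℝ X u (e 1)) (fderiv ℝ X u w)
    -- Cauchy–Schwarz for `(p, q)` and `(c² - d², 2cd)`, the latter of length `c² + d²`.
    have : p * (c ^ 2 - d ^ 2) + q * (2 * c * d) ≤ μ * (c ^ 2 + d ^ 2) := by
      refine le_of_sq_le_sq ?_ (by positivity)
      rw [mul_pow, hsq]
      nlinarith [sq_nonneg (p * (2 * c * d) - q * (c ^ 2 - d ^ 2))]
    linarith

end IsSurfacePatch

/-! ### From the manifold to coordinate patches. -/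

section Coordinates

open Filter Topology

variable {M : Type*} [TopologicalSpace M] [ChartedSpace (EuclideanSpace ℝ (Fin 2)) M]

/-- The coordinate expression of `f : M → S³ ⊂ ℝ⁴` in the preferred chart at `x`. -/
def coordExpr (f : M → S3) (x : M) (u : EuclideanSpace ℝ (Fin 2)) : E4 :=
  f ((extChartAt (𝓡 2) x).symm u)

theorem fact_finrank_E4 : Fact (Module.finrank ℝ E4 = 3 + 1) := ⟨by simp⟩

theorem contMDiff_coe_S3 : ContMDiff (𝓡 3) 𝓘(ℝ, E4) ∞ ((↑) : S3 → E4) :=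
  haveI := fact_finrank_E4
  contMDiff_coe_sphere

theorem mfderiv_coe_S3_injective (x : S3) :
    Function.Injective (mfderiv (𝓡 3) 𝓘(ℝ, E4) ((↑) : S3 → E4) x) :=
  haveI := fact_finrank_E4
  injective_mvfderiv_subtypeVal_sphere x

theorem contMDiff_coe {f : M → S3} (hf : ContMDiff (𝓡 2) (𝓡 3) ∞ f) :
    ContMDiff (𝓡 2) 𝓘(ℝ, E4) ∞ (fun y => (f y : E4)) :=
  contMDiff_coe_S3.comp hf

theorem coordExpr_extChartAt (f : M → S3) (x : M) {y : M}
    (hy : y ∈ (extChartAt (𝓡 2) x).source) : coordExpr f x (extChartAt (𝓡 2) x y) = f y := by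
  rw [coordExpr, (extChartAt (𝓡 2) x).left_inv hy]

/-- The manifold derivative at `x` is by definition taken in the preferred chart at `x`, so the
identification holds on the nose at the base point of that chart. -/
theorem fderiv_coordExpr {f : M → S3} (hf : ContMDiff (𝓡 2) (𝓡 3) ∞ f) (x : M) :
    fderiv ℝ (coordExpr f x) (extChartAt (𝓡 2) x x) = ambientDeriv f x := by
  have hd : MDifferentiableAt (𝓡 2) 𝓘(ℝ, E4) (fun y => (f y : E4)) x :=
    (contMDiff_coe hf).mdifferentiable (by simp) x
  rw [ambientDeriv, hd.mfderiv]
  simp only [modelWithCornersSelf_coe, range_id, fderivWithin_univ]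
  rfl

/-- In adapted charts an immersion is `u ↦ (u, 0)`. Reading off the first factor after `ι` returns
the domain chart, whose derivative is injective; the inclusion of the sphere is an immersion too. -/
theorem ambientDeriv_injective {ι : M → S3} (hι : IsImmersion (𝓡 2) (𝓡 3) ∞ ι) (x : M) :
    Function.Injective (ambientDeriv ι x) := by
  have h := hι.isImmersionAt x
  have hx := h.mem_domChart_source
  have hd : MDifferentiableAt (𝓡 2) (𝓡 3) ι x := hι.contMDiff.mdifferentiable (by simp) x
  have hcoe : MDifferentiableAt (𝓡 3) 𝓘(ℝ, E4) ((↑) : S3 → E4) (ι x) :=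
    contMDiff_coe_S3.mdifferentiable (by simp) _
  have hcomp : ambientDeriv ι x = (mfderiv (𝓡 3) 𝓘(ℝ, E4) ((↑) : S3 → E4) (ι x)).comp
      (mfderiv (𝓡 2) (𝓡 3) ι x) := mfderiv_comp x hcoe hd
  rw [hcomp]
  refine (mfderiv_coe_S3_injective (ι x)).comp ?_
  let L : EuclideanSpace ℝ (Fin 3) →L[ℝ] EuclideanSpace ℝ (Fin 2) :=
    (ContinuousLinearMap.fst ℝ _ h.complement).comp
      (h.equiv.symm : EuclideanSpace ℝ (Fin 3) →L[ℝ] EuclideanSpace ℝ (Fin 2) × h.complement)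
  have hcod : MDifferentiableAt (𝓡 3) 𝓘(ℝ, EuclideanSpace ℝ (Fin 3)) h.codChart (ι x) :=
    (contMDiffAt_of_mem_maximalAtlas h.codChart_mem_maximalAtlas
      h.mem_codChart_source).mdifferentiableAt (by simp)
  have heq : (fun y => L (h.codChart (ι y))) =ᶠ[𝓝 x] h.domChart := by
    filter_upwards [h.domChart.open_source.mem_nhds hx] with y hy
    have h1 := h.writtenInCharts (show h.domChart y ∈ (h.domChart.extend (𝓡 2)).target by
      simpa using h.domChart.map_source hy)
    simp only [Function.comp_apply, OpenPartialHomeomorph.extend_coe,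
      OpenPartialHomeomorph.extend_coe_symm, modelWithCornersSelf_coe,
      modelWithCornersSelf_coe_symm, id, h.domChart.left_inv hy] at h1
    simp [L, h1]
  have hdom : MDifferentiableAt (𝓡 2) 𝓘(ℝ, EuclideanSpace ℝ (Fin 2)) h.domChart x :=
    (contMDiffAt_of_mem_maximalAtlas h.domChart_mem_maximalAtlas hx).mdifferentiableAt (by simp)
  have hinj : Function.Injective (mfderiv (𝓡 2) 𝓘(ℝ, EuclideanSpace ℝ (Fin 2)) h.domChart x) :=
    OpenPartialHomeomorph.MDifferentiable.mfderiv_injective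
      ⟨(contMDiffOn_of_mem_maximalAtlas h.domChart_mem_maximalAtlas).mdifferentiableOn (by simp),
        (contMDiffOn_symm_of_mem_maximalAtlas h.domChart_mem_maximalAtlas).mdifferentiableOn
          (by simp)⟩ hx
  have hL : MDifferentiableAt 𝓘(ℝ, EuclideanSpace ℝ (Fin 3)) 𝓘(ℝ, EuclideanSpace ℝ (Fin 2)) L
      (h.codChart (ι x)) := L.differentiableAt.mdifferentiableAt
  have h2 := mfderiv_comp x (hL.comp _ hcod) hd
  have h3 : mfderiv (𝓡 2) 𝓘(ℝ, EuclideanSpace ℝ (Fin 2)) ((L ∘ h.codChart) ∘ ι) x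
      = mfderiv (𝓡 2) 𝓘(ℝ, EuclideanSpace ℝ (Fin 2)) h.domChart x := heq.mfderiv_eq
  rw [← h3, h2] at hinj
  exact Function.Injective.of_comp hinj

variable [IsManifold (𝓡 2) ∞ M]

theorem contDiffOn_coordExpr {f : M → S3} (hf : ContMDiff (𝓡 2) (𝓡 3) ∞ f) (x : M) :
    ContDiffOn ℝ ∞ (coordExpr f x) (extChartAt (𝓡 2) x).target := by
  rw [← contMDiffOn_iff_contDiffOn]
  exact (contMDiff_coe hf).comp_contMDiffOn (contMDiffOn_extChartAt_symm x)

/-- Away from the base point the two derivatives differ by that of the inverse chart. Being in the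
range of `ambientDeriv` is all that orthogonality to `N` requires. -/
theorem exists_ambientDeriv_eq {f : M → S3} (hf : ContMDiff (𝓡 2) (𝓡 3) ∞ f) (x : M)
    {u : EuclideanSpace ℝ (Fin 2)} (hu : u ∈ (extChartAt (𝓡 2) x).target)
    (w : EuclideanSpace ℝ (Fin 2)) :
    ∃ v, fderiv ℝ (coordExpr f x) u w = ambientDeriv f ((extChartAt (𝓡 2) x).symm u) v := by
  have h1 : MDifferentiableAt 𝓘(ℝ, EuclideanSpace ℝ (Fin 2)) (𝓡 2)
      (extChartAt (𝓡 2) x).symm u :=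
    ((contMDiffOn_extChartAt_symm (n := ∞) x).contMDiffAt
      ((isOpen_extChartAt_target x).mem_nhds hu)).mdifferentiableAt (by simp)
  have h2 : MDifferentiableAt (𝓡 2) 𝓘(ℝ, E4) (fun y => (f y : E4))
      ((extChartAt (𝓡 2) x).symm u) := (contMDiff_coe hf).mdifferentiable (by simp) _
  have h3 := mfderiv_comp u h2 h1
  rw [mfderiv_eq_fderiv] at h3
  refine ⟨mfderiv 𝓘(ℝ, EuclideanSpace ℝ (Fin 2)) (𝓡 2) (extChartAt (𝓡 2) x).symm u w, ?_⟩
  exact congrArg (fun L => L w) h3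

theorem isSurfacePatch_coordExpr {ι N : M → S3} (hι : ContMDiff (𝓡 2) (𝓡 3) ∞ ι)
    (hN : IsUnitNormalField ι N) (x : M) :
    IsSurfacePatch (coordExpr ι x) (coordExpr N x) (extChartAt (𝓡 2) x).target where
  isOpen := isOpen_extChartAt_target x
  smooth_position := contDiffOn_coordExpr hι x
  smooth_normal := contDiffOn_coordExpr hN.smooth x
  norm_position u _ := by simp [coordExpr]
  norm_normal u _ := by simp [coordExpr]
  inner_position_normal u _ := hN.orthogonal_position _
  inner_tangent_normal u hu w := by
    obtain ⟨v, hv⟩ := exists_ambientDeriv_eq hι x hu w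
    rw [hv]
    exact hN.orthogonal_tangent _ v

end Coordinates

end

/-! ### Rolling balls along a closed embedded minimal surface. -/

noncomputable section

open Filter Topology

variable {M : Type*}

/-- Up to a positive factor, `cos t - ⟨F(x, t), ι y⟩` with `Φ = cot t`. It is non-negative if and
only if `ι y` is not in the interior of the ball of geodesic radius `t` that touches the surface at
`ι x` from the side of `N x`. -/
def ballDefect (ι N : M → S3) (Φ : ℝ) (x y : M) : ℝ :=
  Φ * (1 - inner ℝ (ι x : E4) (ι y : E4)) - inner ℝ (N x : E4) (ι y : E4)

theorem inner_S3_le_one (x y : S3) : inner ℝ (x : E4) (y : E4) ≤ 1 := by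
  have := real_inner_le_norm (x : E4) (y : E4)
  simpa using this

theorem inner_S3_lt_one {x y : S3} (h : x ≠ y) : inner ℝ (x : E4) (y : E4) < 1 :=
  (inner_lt_one_iff_real_of_norm_eq_one (by simp) (by simp)).2 fun h' => h (Subtype.ext h')

theorem ballDefect_mono (ι N : M → S3) {Φ Ψ : ℝ} (h : Φ ≤ Ψ) (x y : M) :
    ballDefect ι N Φ x y ≤ ballDefect ι N Ψ x y := by
  have := inner_S3_le_one (ι x) (ι y)
  unfold ballDefect
  nlinarith

variable [TopologicalSpace M]

theorem continuous_ballDefect {ι N : M → S3} (hι : Continuous ι) (hN : Continuous N) (Φ : ℝ) :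
    Continuous fun p : M × M => ballDefect ι N Φ p.1 p.2 := by
  unfold ballDefect
  fun_prop

theorem eventually_ballDefect_nonneg_of_pos {ι N : M → S3} (hι : Continuous ι) (hN : Continuous N)
    {Φ : ℝ} {x y : M} (h : 0 < ballDefect ι N Φ x y) :
    ∀ᶠ q : M × M in 𝓝 (x, y), 0 ≤ ballDefect ι N Φ q.1 q.2 :=
  ((continuous_ballDefect hι hN Φ).tendsto (x, y)).eventually_const_le h

/-- Local non-negativity of `ballDefect` can be glued, by compactness. -/
theorem exists_forall_ballDefect_nonneg [CompactSpace M] {ι N : M → S3} {I : Set ℝ}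
    (hne : I.Nonempty) (hI : ∀ a ∈ I, ∀ b ∈ I, max a b ∈ I)
    (h : ∀ p : M × M, ∃ Φ ∈ I, ∀ᶠ q : M × M in 𝓝 p, 0 ≤ ballDefect ι N Φ q.1 q.2) :
    ∃ Φ ∈ I, ∀ x y, 0 ≤ ballDefect ι N Φ x y := by
  have := isCompact_univ.induction_on
    (p := fun s : Set (M × M) => ∃ Φ ∈ I, ∀ q ∈ s, 0 ≤ ballDefect ι N Φ q.1 q.2)
    (let ⟨Φ, hΦ⟩ := hne; ⟨Φ, hΦ, by simp⟩)
    (fun s t hst ⟨Φ, hΦ, ht⟩ => ⟨Φ, hΦ, fun q hq => ht q (hst hq)⟩)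
    -- By monotonicity in the parameter, the larger of two values serves on the union.
    (fun s t ⟨Φ, hΦ, hs⟩ ⟨Ψ, hΨ, ht⟩ => ⟨max Φ Ψ, hI _ hΦ _ hΨ, fun q hq => hq.elim
      (fun hq => (hs q hq).trans (ballDefect_mono ι N (le_max_left _ _) _ _))
      (fun hq => (ht q hq).trans (ballDefect_mono ι N (le_max_right _ _) _ _))⟩)
    (fun p _ => let ⟨Φ, hΦ, hp⟩ := h p; ⟨_, mem_nhdsWithin_of_mem_nhds hp, Φ, hΦ, fun q hq => hq⟩)
  obtain ⟨Φ, hΦ, hq⟩ := this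
  exact ⟨Φ, hΦ, fun x y => hq (x, y) trivial⟩

section MinimalSurface

variable [ChartedSpace (EuclideanSpace ℝ (Fin 2)) M]
variable {ι N : M → S3}

theorem sum_inner_fderiv_coordExpr_eq_zero (hι : ContMDiff (𝓡 2) (𝓡 3) ∞ ι)
    (hN : IsUnitNormalField ι N) (hmin : IsMinimalSurface ι N) (x : M)
    (e : Fin 2 → EuclideanSpace ℝ (Fin 2))
    (he : Orthonormal ℝ fun i => fderiv ℝ (coordExpr ι x) (extChartAt (𝓡 2) x x) (e i)) :
    ∑ i, inner ℝ (fderiv ℝ (coordExpr ι x) (extChartAt (𝓡 2) x x) (e i))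
      (fderiv ℝ (coordExpr N x) (extChartAt (𝓡 2) x x) (e i)) = 0 := by
  rw [fderiv_coordExpr hι] at he ⊢
  rw [fderiv_coordExpr hN.smooth]
  have h := hmin x e fun i j => orthonormal_iff_ite.1 he i j
  simp only [secondFundamentalForm, Finset.sum_neg_distrib, neg_eq_zero] at h
  rw [← h]
  exact Finset.sum_congr rfl fun i _ => real_inner_comm _ _

theorem firstFundamentalForm_pos (hι : IsImmersion (𝓡 2) (𝓡 3) ∞ ι) (x : M)
    {w : TangentSpace (𝓡 2) x} (hw : w ≠ 0) : 0 < firstFundamentalForm ι x w w := by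
  refine real_inner_self_pos.2 fun h => hw ?_
  exact ambientDeriv_injective hι x (h.trans (map_zero _).symm)

variable [IsManifold (𝓡 2) ∞ M]

/-- The non-negative principal curvature of a minimal surface is the maximum of the normal
curvatures. -/
theorem nonnegPrincipalCurvature_spec (hι : IsImmersion (𝓡 2) (𝓡 3) ∞ ι)
    (hN : IsUnitNormalField ι N) (hmin : IsMinimalSurface ι N) (x : M) :
    0 ≤ nonnegPrincipalCurvature ι N x ∧
      IsPrincipalCurvature ι N x (nonnegPrincipalCurvature ι N x) ∧
      ∀ w, secondFundamentalForm ι N x w w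
        ≤ nonnegPrincipalCurvature ι N x * firstFundamentalForm ι x w w := by
  have hp := isSurfacePatch_coordExpr hι.contMDiff hN x
  have inj := ambientDeriv_injective hι x
  have tr := sum_inner_fderiv_coordExpr_eq_zero hι.contMDiff hN hmin x
  rw [← fderiv_coordExpr hι.contMDiff x] at inj
  obtain ⟨μ, h0, h1, h2, h3⟩ := hp.exists_principalCurvature (mem_extChartAt_target x) inj tr
  simp only [fderiv_coordExpr hι.contMDiff, fderiv_coordExpr hN.smooth] at h1 h2 h3
  have hset : {lam : ℝ | 0 ≤ lam ∧ IsPrincipalCurvature ι N x lam} = {μ} := by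
    ext κ
    exact ⟨fun h => h2 κ h.1 h.2, fun h => by rw [mem_singleton_iff.1 h]; exact ⟨h0, h1⟩⟩
  have hval : nonnegPrincipalCurvature ι N x = μ := by
    rw [nonnegPrincipalCurvature, hset, csSup_singleton]
  rw [hval]
  refine ⟨h0, h1, fun w => ?_⟩
  rw [secondFundamentalForm, real_inner_comm]
  exact h3 w

theorem pos_of_nonnegPrincipalCurvature_lt (hι : IsImmersion (𝓡 2) (𝓡 3) ∞ ι)
    (hN : IsUnitNormalField ι N) (hmin : IsMinimalSurface ι N) {x : M} {Φ : ℝ}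
    (hΦ : nonnegPrincipalCurvature ι N x < Φ) {w : TangentSpace (𝓡 2) x} (hw : w ≠ 0) :
    0 < Φ * inner ℝ (ambientDeriv ι x w) (ambientDeriv ι x w)
      + inner ℝ (ambientDeriv ι x w) (ambientDeriv N x w) := by
  have h1 := (nonnegPrincipalCurvature_spec hι hN hmin x).2.2 w
  have h2 := firstFundamentalForm_pos hι x hw
  rw [secondFundamentalForm, real_inner_comm] at h1
  rw [firstFundamentalForm] at h1 h2
  nlinarith

theorem eventually_ballDefect_nonneg (hι : IsImmersion (𝓡 2) (𝓡 3) ∞ ι)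
    (hN : IsUnitNormalField ι N) (hmin : IsMinimalSurface ι N) {x : M} {Φ : ℝ}
    (hΦ : nonnegPrincipalCurvature ι N x < Φ) :
    ∀ᶠ q : M × M in 𝓝 (x, x), 0 ≤ ballDefect ι N Φ q.1 q.2 := by
  have hp := isSurfacePatch_coordExpr hι.contMDiff hN x
  have h := hp.eventually_nonneg (Φ := Φ) (mem_extChartAt_target x) fun w hw => by
    rw [fderiv_coordExpr hι.contMDiff, fderiv_coordExpr hN.smooth]
    exact pos_of_nonnegPrincipalCurvature_lt hι hN hmin hΦ (x := x) hw
  have hc : Tendsto (fun q : M × M => (extChartAt (𝓡 2) x q.1, extChartAt (𝓡 2) x q.2))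
      (𝓝 (x, x)) (𝓝 (extChartAt (𝓡 2) x x, extChartAt (𝓡 2) x x)) :=
    ((continuousAt_extChartAt x).comp (x := (x, x)) continuousAt_fst).prodMk_nhds
      ((continuousAt_extChartAt x).comp (x := (x, x)) continuousAt_snd)
  have hs : ∀ᶠ q : M × M in 𝓝 (x, x), q.1 ∈ (extChartAt (𝓡 2) x).source ∧
      q.2 ∈ (extChartAt (𝓡 2) x).source :=
    have h1 := extChartAt_source_mem_nhds (I := 𝓡 2) x
    inter_mem (continuousAt_fst (p := (x, x)) h1) (continuousAt_snd (p := (x, x)) h1)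
  filter_upwards [hc.eventually h, hs] with q hq hqs
  rwa [coordExpr_extChartAt _ _ hqs.1, coordExpr_extChartAt _ _ hqs.2,
    coordExpr_extChartAt _ _ hqs.1] at hq

/-- The defect vanishes on the diagonal, so `(x, x)` is a minimum. Moving only the second point
along a principal direction `v`, the second variation is `(Φ - λ)|v|²`. -/
theorem nonnegPrincipalCurvature_le_of_ballDefect (hι : IsImmersion (𝓡 2) (𝓡 3) ∞ ι)
    (hN : IsUnitNormalField ι N) (hmin : IsMinimalSurface ι N) {Φ : ℝ}
    (h : ∀ x y, 0 ≤ ballDefect ι N Φ x y) (x : M) : nonnegPrincipalCurvature ι N x ≤ Φ := by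
  have hp := isSurfacePatch_coordExpr hι.contMDiff hN x
  obtain ⟨-, ⟨v, hv0, hv⟩, -⟩ := nonnegPrincipalCurvature_spec hι hN hmin x
  have hu := mem_extChartAt_target (I := 𝓡 2) x
  have h1 := hp.norm_position _ hu
  have h2 := hp.inner_position_normal _ hu
  have hvar := (hp.variation hp hu hu (Φ := Φ)
    (by rw [real_inner_self_eq_norm_sq, h1, real_inner_comm, h2]; norm_num)
    (.of_forall fun p => h _ _) 0 v).2
  have h3 := hp.inner_second_position_position hu v v
  have h4 := hp.inner_second_position_normal hu v v
  rw [real_inner_comm] at h3 h4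
  simp only [map_zero, inner_zero_left, mul_zero, zero_add, h3, h4] at hvar
  rw [fderiv_coordExpr hι.contMDiff, fderiv_coordExpr hN.smooth] at hvar
  have h5 := hv v
  have h6 := firstFundamentalForm_pos hι x hv0
  rw [secondFundamentalForm, real_inner_comm] at h5
  rw [firstFundamentalForm] at h5 h6
  have h7 : 0 ≤ -(Φ * -inner ℝ (ambientDeriv ι x v) (ambientDeriv ι x v))
      - -inner ℝ (ambientDeriv ι x v) (ambientDeriv N x v) := hvar
  by_contra! hlt
  nlinarith

theorem eq_of_ballDefect_eq_zero (hι : IsSmoothEmbedding (𝓡 2) (𝓡 3) ∞ ι)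
    (hN : IsUnitNormalField ι N) (hmin : IsMinimalSurface ι N) {Φ : ℝ} (hΦ1 : 1 ≤ Φ)
    (h : ∀ x y, 0 ≤ ballDefect ι N Φ x y) {x y : M} (hΦ : nonnegPrincipalCurvature ι N x < Φ)
    (h0 : ballDefect ι N Φ x y = 0) : x = y := by
  have hι' := hι.isImmersion
  have hs := hι'.contMDiff
  have key := (isSurfacePatch_coordExpr hs hN x).position_eq_of_touching
    (isSurfacePatch_coordExpr hs hN y) (mem_extChartAt_target x) (mem_extChartAt_target y)
    (by rw [fderiv_coordExpr hs]; exact ambientDeriv_injective hι' x)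
    (by rw [fderiv_coordExpr hs]; exact ambientDeriv_injective hι' y)
    (sum_inner_fderiv_coordExpr_eq_zero hs hN hmin x)
    (sum_inner_fderiv_coordExpr_eq_zero hs hN hmin y) hΦ1
    (fun w hw => by
      rw [fderiv_coordExpr hs, fderiv_coordExpr hN.smooth]
      exact pos_of_nonnegPrincipalCurvature_lt hι' hN hmin hΦ (x := x) hw)
    (by
      rw [coordExpr_extChartAt _ _ (mem_extChartAt_source x),
        coordExpr_extChartAt _ _ (mem_extChartAt_source x),
        coordExpr_extChartAt _ _ (mem_extChartAt_source y)]
      exact h0)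
    (.of_forall fun p => h _ _)
  rw [coordExpr_extChartAt _ _ (mem_extChartAt_source x),
    coordExpr_extChartAt _ _ (mem_extChartAt_source y)] at key
  exact hι.isEmbedding.injective (Subtype.ext key)

variable [CompactSpace M]

/-- Near `(x, x)` any value above the principal curvature at `x` works; off the diagonal
embeddedness gives `⟨ι x, ι y⟩ < 1`, and a large multiple of the gap beats `⟨N x, ι y⟩ ≤ 1`. -/
theorem exists_ballDefect_nonneg (hι : IsSmoothEmbedding (𝓡 2) (𝓡 3) ∞ ι)
    (hN : IsUnitNormalField ι N) (hmin : IsMinimalSurface ι N) :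
    ∃ Φ, ∀ x y, 0 ≤ ballDefect ι N Φ x y := by
  obtain ⟨Φ, -, h⟩ := exists_forall_ballDefect_nonneg (ι := ι) (N := N) (I := univ) univ_nonempty
    (fun _ _ _ _ => trivial) (by
      rintro ⟨x, y⟩
      rcases eq_or_ne x y with rfl | hxy
      · exact ⟨_, trivial, eventually_ballDefect_nonneg hι.isImmersion hN hmin (lt_add_one _)⟩
      · have h1 := inner_S3_lt_one (hι.isEmbedding.injective.ne hxy)
        set δ := 1 - inner ℝ (ι x : E4) (ι y : E4) with hδ
        have hδ0 : 0 < δ := by linarith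
        refine ⟨2 / δ, trivial, eventually_ballDefect_nonneg_of_pos hι.isEmbedding.continuous
          hN.smooth.continuous ?_⟩
        have h2 := inner_S3_le_one (N x) (ι y)
        have h3 : 2 / δ * δ = 2 := div_mul_cancel₀ _ hδ0.ne'
        simp only [ballDefect, ← hδ, h3]
        linarith)
  exact ⟨Φ, h⟩

/-- A single global touching ball bounds all principal curvatures, so their continuity need not be
proved. Boundedness makes the supremum in `maxPrincipalCurvature` meaningful. -/
theorem bddAbove_nonnegPrincipalCurvature (hι : IsSmoothEmbedding (𝓡 2) (𝓡 3) ∞ ι)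
    (hN : IsUnitNormalField ι N) (hmin : IsMinimalSurface ι N) :
    BddAbove (range (nonnegPrincipalCurvature ι N)) := by
  obtain ⟨Φ, h⟩ := exists_ballDefect_nonneg hι hN hmin
  exact ⟨Φ, forall_mem_range.2
    (nonnegPrincipalCurvature_le_of_ballDefect hι.isImmersion hN hmin h)⟩

/-- On a closed embedded minimal surface, balls of geodesic radius at most `π / 4` whose curvature
exceeds the maximal principal curvature can be rolled along the surface. -/
theorem ballDefect_nonneg (hι : IsSmoothEmbedding (𝓡 2) (𝓡 3) ∞ ι)
    (hN : IsUnitNormalField ι N) (hmin : IsMinimalSurface ι N) {Φ : ℝ} (hΦ1 : 1 ≤ Φ)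
    (hΦ : maxPrincipalCurvature ι N < Φ) (x y : M) : 0 ≤ ballDefect ι N Φ x y := by
  have hle : ∀ x, nonnegPrincipalCurvature ι N x < Φ := fun x =>
    (le_ciSup (bddAbove_nonnegPrincipalCurvature hι hN hmin) x).trans_lt hΦ
  let S : Set ℝ := {Ψ | Φ ≤ Ψ ∧ ∀ x y, 0 ≤ ballDefect ι N Ψ x y}
  have hSne : S.Nonempty := by
    obtain ⟨Ψ, h⟩ := exists_ballDefect_nonneg hι hN hmin
    exact ⟨max Φ Ψ, le_max_left _ _, fun x y =>
      (h x y).trans (ballDefect_mono ι N (le_max_right _ _) x y)⟩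
  have hSb : BddBelow S := ⟨Φ, fun Ψ h => h.1⟩
  have hScl : IsClosed S := by
    simp only [S, ofPred_and, ofPred_forall]
    refine isClosed_Ici.inter (isClosed_iInter fun x => isClosed_iInter fun y => ?_)
    unfold ballDefect
    exact isClosed_le continuous_const (by fun_prop)
  obtain ⟨h1, h2⟩ := hScl.csInf_mem hSne hSb
  rcases h1.eq_or_lt with h3 | h3
  · rw [h3]; exact h2 x y
  -- If the infimum exceeds `Φ`, each pair has a neighbourhood where a parameter below the infimum
  -- works; gluing these contradicts minimality.
  · exfalso
    set Ψ := sInf S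
    obtain ⟨Ψ', hΨ', h4⟩ := exists_forall_ballDefect_nonneg (ι := ι) (N := N) (I := Iio Ψ)
      ⟨Φ, h3⟩ (fun _ ha _ hb => mem_Iio.2 (max_lt ha hb)) (by
        rintro ⟨x, y⟩
        rcases eq_or_ne x y with rfl | hxy
        · exact ⟨Φ, h3, eventually_ballDefect_nonneg hι.isImmersion hN hmin (hle x)⟩
        -- The maximum principle excludes a zero off the diagonal, and strict positivity leaves room
        -- to lower the parameter.
        · have hpos : 0 < ballDefect ι N Ψ x y := lt_of_le_of_ne (h2 x y) fun h0 =>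
            hxy (eq_of_ballDefect_eq_zero hι hN hmin (hΦ1.trans h1) h2
              ((hle x).trans h3) h0.symm)
          have hcΨ : Continuous fun Ψ => ballDefect ι N Ψ x y := by
            unfold ballDefect; fun_prop
          obtain ⟨Ψ', h5, h6⟩ := ((hcΨ.continuousAt.eventually (lt_mem_nhds hpos)).filter_mono
            nhdsWithin_le_nhds |>.and (self_mem_nhdsWithin (a := Ψ) (s := Iio Ψ))).exists
          exact ⟨Ψ', h6, eventually_ballDefect_nonneg_of_pos hι.isEmbedding.continuous
            hN.smooth.continuous h5⟩)
    have h5 : max Φ Ψ' ∈ S := ⟨le_max_left _ _, fun x y =>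
      (h4 x y).trans (ballDefect_mono ι N (le_max_right _ _) x y)⟩
    have h6 : Ψ ≤ max Φ Ψ' := csInf_le hSb h5
    exact (max_lt h3 (mem_Iio.1 hΨ')).not_ge h6

end MinimalSurface

end

/-! ### The normal exponential map: local inverses and injectivity. -/

noncomputable section

open Filter Topology

/-- The cone over the normal exponential map of a surface patch. -/
def coneExp (X N : EuclideanSpace ℝ (Fin 2) → E4) (z : EuclideanSpace ℝ (Fin 2) × ℝ × ℝ) : E4 :=
  z.2.2 • (cos z.2.1 • X z.1 + sin z.2.1 • N z.1)

namespace IsSurfacePatch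

variable {X N : EuclideanSpace ℝ (Fin 2) → E4} {T : Set (EuclideanSpace ℝ (Fin 2))}
  {u : EuclideanSpace ℝ (Fin 2)}

theorem contDiffAt_coneExp (h : IsSurfacePatch X N T)
    {z : EuclideanSpace ℝ (Fin 2) × ℝ × ℝ} (hz : z.1 ∈ T) : ContDiffAt ℝ ∞ (coneExp X N) z := by
  have hX : ContDiffAt ℝ ∞ (fun z : EuclideanSpace ℝ (Fin 2) × ℝ × ℝ => X z.1) z :=
    (h.smooth_position.contDiffAt (h.isOpen.mem_nhds hz)).comp z contDiffAt_fst
  have hN : ContDiffAt ℝ ∞ (fun z : EuclideanSpace ℝ (Fin 2) × ℝ × ℝ => N z.1) z :=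
    (h.smooth_normal.contDiffAt (h.isOpen.mem_nhds hz)).comp z contDiffAt_fst
  have ht : ContDiffAt ℝ ∞ (fun z : EuclideanSpace ℝ (Fin 2) × ℝ × ℝ => z.2.1) z := by fun_prop
  have hr : ContDiffAt ℝ ∞ (fun z : EuclideanSpace ℝ (Fin 2) × ℝ × ℝ => z.2.2) z := by fun_prop
  exact hr.smul ((ht.cos.smul hX).add (ht.sin.smul hN))

theorem fderiv_coneExp_apply (h : IsSurfacePatch X N T) (hu : u ∈ T) (t : ℝ)
    (w : EuclideanSpace ℝ (Fin 2)) (τ ρ : ℝ) :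
    fderiv ℝ (coneExp X N) (u, t, 1) (w, τ, ρ) =
      ρ • (cos t • X u + sin t • N u) + τ • (-sin t • X u + cos t • N u)
        + (cos t • fderiv ℝ X u w + sin t • fderiv ℝ N u w) := by
  have h0 : u + (0 : ℝ) • w ∈ T := by simpa using hu
  have dX : HasDerivAt (fun s : ℝ => X (u + s • w)) (fderiv ℝ X (u + (0 : ℝ) • w) w) 0 :=
    hasDerivAt_comp_line h.isOpen h.smooth_position h0
  have dN : HasDerivAt (fun s : ℝ => N (u + s • w)) (fderiv ℝ N (u + (0 : ℝ) • w) w) 0 :=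
    hasDerivAt_comp_line h.isOpen h.smooth_normal h0
  have dt : HasDerivAt (fun s : ℝ => t + s • τ) τ 0 := hasDerivAt_line t τ 0
  have dr : HasDerivAt (fun s : ℝ => (1 : ℝ) + s • ρ) ρ 0 := hasDerivAt_line 1 ρ 0
  have d1 := dr.smul ((dt.cos.smul dX).add (dt.sin.smul dN))
  have hd : HasFDerivAt (coneExp X N) (fderiv ℝ (coneExp X N) (u, t, 1))
      ((u, t, 1) + (0 : ℝ) • (w, τ, ρ)) := by
    rw [zero_smul, add_zero]
    exact ((h.contDiffAt_coneExp (z := (u, t, 1)) hu).differentiableAt (by simp)).hasFDerivAt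
  have d2 := hd.comp_hasDerivAt 0 (hasDerivAt_line (u, t, 1) (w, τ, ρ) 0)
  have d3 := d2.unique d1
  simp only [zero_smul, zero_mul, add_zero, smul_eq_mul, Pi.add_apply, Pi.smul_apply',
    one_smul] at d3
  rw [d3]
  module

/-- Before the focal distance the cone over the normal exponential map is an immersion. -/
theorem exists_equiv_fderiv_coneExp (h : IsSurfacePatch X N T) (hu : u ∈ T) {t : ℝ}
    (hpos : ∀ w, w ≠ 0 → 0 < cos t * inner ℝ (fderiv ℝ X u w) (fderiv ℝ X u w)
      + sin t * inner ℝ (fderiv ℝ X u w) (fderiv ℝ N u w)) :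
    ∃ G : (EuclideanSpace ℝ (Fin 2) × ℝ × ℝ) ≃L[ℝ] E4,
      fderiv ℝ (coneExp X N) (u, t, 1) = G := by
  have hinj : Function.Injective (fderiv ℝ (coneExp X N) (u, t, 1)) := by
    rw [injective_iff_map_eq_zero]
    rintro ⟨w, τ, ρ⟩ hz
    rw [h.fderiv_coneExp_apply hu] at hz
    have nX : inner ℝ (X u) (X u) = 1 := by
      rw [real_inner_self_eq_norm_sq, h.norm_position u hu]; norm_num
    have nN : inner ℝ (N u) (N u) = 1 := by
      rw [real_inner_self_eq_norm_sq, h.norm_normal u hu]; norm_num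
    have iXN := h.inner_position_normal u hu
    have iNX := (real_inner_comm _ _).trans iXN
    have hcs := sin_sq_add_cos_sq t
    -- Products with `X u` and `N u` determine `ρ` and `τ` by a rotation through `t`; the product
    -- with the tangent vector leaves the positive form in `w`.
    have e1 := congrArg (fun v => inner ℝ v (X u)) hz
    have e2 := congrArg (fun v => inner ℝ v (N u)) hz
    have e3 := congrArg (fun v => inner ℝ (fderiv ℝ X u w) v) hz
    simp only [inner_add_left, inner_add_right, real_inner_smul_left, real_inner_smul_right,
      inner_zero_left, inner_zero_right, nX, nN, iXN, iNX, h.inner_tangent_position hu,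
      h.inner_tangent_normal u hu, h.inner_fderiv_normal_position hu,
      h.inner_fderiv_normal_normal hu] at e1 e2 e3
    have hρ : ρ = 0 := by linear_combination cos t * e1 + sin t * e2 - ρ * hcs
    have hτ : τ = 0 := by linear_combination cos t * e2 - sin t * e1 - τ * hcs
    have hw : w = 0 := by
      by_contra hw
      have := hpos w hw
      linarith
    simp [hw, hτ, hρ]
  have hfin : Module.finrank ℝ (EuclideanSpace ℝ (Fin 2) × ℝ × ℝ) = Module.finrank ℝ E4 := by
    simp
  refine ⟨(LinearEquiv.ofInjectiveOfFinrankEq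
    (fderiv ℝ (coneExp X N) (u, t, 1) : (EuclideanSpace ℝ (Fin 2) × ℝ × ℝ) →ₗ[ℝ] E4)
    hinj hfin).toContinuousLinearEquiv, ?_⟩
  exact ContinuousLinearMap.ext fun z => rfl

end IsSurfacePatch

section RollingRadius

variable {M : Type*} [TopologicalSpace M] [ChartedSpace (EuclideanSpace ℝ (Fin 2)) M]
  {ι N : M → S3}

theorem cot_bounds_of_lt_rollingRadius (hΛ : 0 ≤ maxPrincipalCurvature ι N) {t : ℝ} (ht0 : 0 < t)
    (ht : t < rollingRadius ι N) :
    0 < sin t ∧ 1 ≤ cos t / sin t ∧ maxPrincipalCurvature ι N < cos t / sin t := by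
  have h4 : t < π / 4 := ht.trans_le (min_le_right _ _)
  have hπ := pi_pos
  have hs : 0 < sin t := sin_pos_of_pos_of_lt_pi ht0 (by linarith)
  have hc : 0 < cos t := cos_pos_of_mem_Ioo ⟨by linarith, by linarith⟩
  have hsc : sin t ≤ cos t := by
    rw [← cos_pi_div_two_sub]
    exact cos_le_cos_of_nonneg_of_le_pi ht0.le (by linarith) (by linarith)
  refine ⟨hs, (one_le_div hs).2 hsc, ?_⟩
  rcases hΛ.eq_or_lt with h0 | h0
  -- In the totally geodesic case the bound only asks that `cot t > 0`.
  · rw [← h0]; positivity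
  · have h1 : t < arctan (1 / maxPrincipalCurvature ι N) := by
      have := ht.trans_le (min_le_left _ _)
      rwa [if_neg h0.ne'] at this
    have h2 : tan t < 1 / maxPrincipalCurvature ι N := by
      rw [← tan_arctan (1 / maxPrincipalCurvature ι N)]
      exact tan_lt_tan_of_lt_of_lt_pi_div_two (by linarith) (arctan_lt_pi_div_two _) h1
    rw [tan_eq_sin_div_cos, div_lt_div_iff₀ hc h0] at h2
    rw [lt_div_iff₀ hs]
    linarith

theorem inner_normalExp (hN : IsUnitNormalField ι N) (p : M × ℝ) (y : M) :
    inner ℝ (normalExp ι N hN p : E4) (ι y : E4)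
      = cos p.2 * inner ℝ (ι p.1 : E4) (ι y : E4) + sin p.2 * inner ℝ (N p.1 : E4) (ι y : E4) := by
  simp only [normalExp, inner_add_left, real_inner_smul_left]

theorem inner_normalExp_self (hN : IsUnitNormalField ι N) (p : M × ℝ) :
    inner ℝ (normalExp ι N hN p : E4) (ι p.1 : E4) = cos p.2 := by
  rw [inner_normalExp, real_inner_comm _ (N p.1 : E4), hN.orthogonal_position,
    real_inner_self_eq_norm_sq]
  simp

variable [IsManifold (𝓡 2) ∞ M]

theorem contMDiff_normalExp (hι : ContMDiff (𝓡 2) (𝓡 3) ∞ ι) (hN : IsUnitNormalField ι N) :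
    ContMDiff ((𝓡 2).prod 𝓘(ℝ, ℝ)) (𝓡 3) ∞ (normalExp ι N hN) := by
  have := fact_finrank_E4
  have h1 : ContMDiff ((𝓡 2).prod 𝓘(ℝ, ℝ)) 𝓘(ℝ, E4) ∞ fun p : M × ℝ => (ι p.1 : E4) :=
    (contMDiff_coe hι).comp contMDiff_fst
  have h2 : ContMDiff ((𝓡 2).prod 𝓘(ℝ, ℝ)) 𝓘(ℝ, E4) ∞ fun p : M × ℝ => (N p.1 : E4) :=
    (contMDiff_coe hN.smooth).comp contMDiff_fst
  have h3 : ContMDiff ((𝓡 2).prod 𝓘(ℝ, ℝ)) 𝓘(ℝ, ℝ) ∞ fun p : M × ℝ => cos p.2 :=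
    Real.contDiff_cos.contMDiff.comp contMDiff_snd
  have h4 : ContMDiff ((𝓡 2).prod 𝓘(ℝ, ℝ)) 𝓘(ℝ, ℝ) ∞ fun p : M × ℝ => sin p.2 :=
    Real.contDiff_sin.contMDiff.comp contMDiff_snd
  exact ContMDiff.codRestrict_sphere ((h3.smul h1).add (h4.smul h2)) _

theorem maxPrincipalCurvature_nonneg (hι : IsSmoothEmbedding (𝓡 2) (𝓡 3) ∞ ι)
    (hN : IsUnitNormalField ι N) (hmin : IsMinimalSurface ι N) :
    0 ≤ maxPrincipalCurvature ι N :=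
  Real.iSup_nonneg fun x => (nonnegPrincipalCurvature_spec hι.isImmersion hN hmin x).1

/-- Before the focal distance the normal exponential map has a smooth local inverse. -/
theorem exists_local_inverse_normalExp (hι : IsImmersion (𝓡 2) (𝓡 3) ∞ ι)
    (hN : IsUnitNormalField ι N) {x : M} {t : ℝ}
    (hpos : ∀ w : TangentSpace (𝓡 2) x, w ≠ 0 →
      0 < cos t * inner ℝ (ambientDeriv ι x w) (ambientDeriv ι x w)
        + sin t * inner ℝ (ambientDeriv ι x w) (ambientDeriv N x w)) :
    ∃ (U : Set S3) (g : S3 → M × ℝ), IsOpen U ∧ normalExp ι N hN (x, t) ∈ U ∧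
      ContMDiffOn (𝓡 3) ((𝓡 2).prod 𝓘(ℝ, ℝ)) ∞ g U ∧
      ∀ᶠ q in 𝓝 (x, t), g (normalExp ι N hN q) = q := by
  have hs := hι.contMDiff
  have hP := isSurfacePatch_coordExpr hs hN x
  have hu := mem_extChartAt_target (I := 𝓡 2) x
  set φ := extChartAt (𝓡 2) x with hφ
  obtain ⟨G, hG⟩ := hP.exists_equiv_fderiv_coneExp hu (t := t) fun w hw => by
    rw [fderiv_coordExpr hs, fderiv_coordExpr hN.smooth]
    exact hpos w hw
  set E := coneExp (coordExpr ι x) (coordExpr N x) with hE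
  set z₀ : EuclideanSpace ℝ (Fin 2) × ℝ × ℝ := (φ x, t, 1) with hz₀
  have hcd : ContDiffAt ℝ ∞ E z₀ := hP.contDiffAt_coneExp hu
  have hfd : HasFDerivAt E (G : _ →L[ℝ] E4) z₀ := by
    rw [← hG]
    exact (hcd.differentiableAt (by simp)).hasFDerivAt
  -- The radial variable makes the dimensions agree, so the inverse function theorem applies in ℝ⁴
  -- without charts of the sphere.
  let e := hcd.toOpenPartialHomeomorph E hfd (by simp)
  have he : ∀ z, e z = E z := fun z => rfl
  have hz₀e : z₀ ∈ e.source := hcd.mem_toOpenPartialHomeomorph_source hfd (by simp)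
  have hO : ∀ᶠ z in 𝓝 z₀, z ∈ e.source ∧ z.1 ∈ φ.target ∧
      fderiv ℝ E z ∈ range ((↑) : ((EuclideanSpace ℝ (Fin 2) × ℝ × ℝ) ≃L[ℝ] E4) → _) := by
    refine Eventually.and (e.open_source.mem_nhds hz₀e) (Eventually.and ?_ ?_)
    · exact continuousAt_fst (p := z₀) (hP.isOpen.mem_nhds hu)
    · exact (hcd.fderiv_right (m := 0) (by simp)).continuousAt
        (ContinuousLinearEquiv.isOpen.mem_nhds ⟨G, hG.symm⟩)
  -- The derivative is invertible throughout `O`, so the inverse is smooth on a whole open set and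
  -- not only at one point.
  obtain ⟨O, hOsub, hOopen, hz₀O⟩ := mem_nhds_iff.1 hO
  let W : Set E4 := e.target ∩ e.symm ⁻¹' O
  have hW : IsOpen W := e.isOpen_inter_preimage_symm hOopen
  have hmemW : ∀ z ∈ O, E z ∈ W := fun z hz =>
    ⟨e.map_source (hOsub hz).1, by
      rw [mem_preimage, ← he, e.left_inv (hOsub hz).1]; exact hz⟩
  have hsymm : ContDiffOn ℝ ∞ e.symm W := fun a ha => by
    obtain ⟨-, hT, G', hG'⟩ := hOsub ha.2
    have hc' : ContDiffAt ℝ ∞ E (e.symm a) := hP.contDiffAt_coneExp hT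
    refine (e.contDiffAt_symm ha.1 (f₀' := G') ?_ hc').contDiffWithinAt
    rw [hG']
    exact (hc'.differentiableAt (by simp)).hasFDerivAt
  have hEF : ∀ q : M × ℝ, q.1 ∈ φ.source → E (φ q.1, q.2, 1) = normalExp ι N hN q := by
    intro q hq
    simp only [hE, coneExp, one_smul, normalExp]
    rw [coordExpr_extChartAt _ _ hq, coordExpr_extChartAt _ _ hq]
  refine ⟨(↑) ⁻¹' W, fun y => (φ.symm (e.symm (y : E4)).1, (e.symm (y : E4)).2.1),
    hW.preimage continuous_subtype_val, ?_, ?_, ?_⟩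
  · rw [mem_preimage, ← hEF (x, t) (mem_extChartAt_source x)]
    exact hmemW _ hz₀O
  · have h1 : ContMDiffOn (𝓡 3) 𝓘(ℝ, EuclideanSpace ℝ (Fin 2) × ℝ × ℝ) ∞
        (fun y : S3 => e.symm (y : E4)) ((↑) ⁻¹' W) :=
      hsymm.contMDiffOn.comp contMDiff_coe_S3.contMDiffOn fun y hy => hy
    have h2 : ContMDiffOn (𝓡 3) 𝓘(ℝ, EuclideanSpace ℝ (Fin 2)) ∞
        (fun y : S3 => (e.symm (y : E4)).1) ((↑) ⁻¹' W) :=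
      contDiff_fst.contMDiff.comp_contMDiffOn h1
    have h3 : ContMDiffOn (𝓡 3) 𝓘(ℝ, ℝ) ∞
        (fun y : S3 => (e.symm (y : E4)).2.1) ((↑) ⁻¹' W) :=
      (contDiff_fst.comp contDiff_snd).contMDiff.comp_contMDiffOn h1
    exact ((contMDiffOn_extChartAt_symm x).comp h2 fun y hy => (hOsub hy.2).2.1).prodMk h3
  · have hc : Tendsto (fun q : M × ℝ => (φ q.1, q.2, (1 : ℝ))) (𝓝 (x, t)) (𝓝 z₀) :=
      ((continuousAt_extChartAt x).comp (x := (x, t)) continuousAt_fst).prodMk_nhds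
        (continuousAt_snd.prodMk_nhds tendsto_const_nhds)
    filter_upwards [hc (hOopen.mem_nhds hz₀O),
      continuousAt_fst (p := (x, t)) (extChartAt_source_mem_nhds (I := 𝓡 2) x)] with q hq hqs
    have hqs' : q.1 ∈ φ.source := hqs
    have h1 : e.symm (normalExp ι N hN q : E4) = (φ q.1, q.2, 1) := by
      rw [← hEF q hqs', ← he]
      exact e.left_inv (hOsub hq).1
    simp only [h1]
    rw [φ.left_inv hqs']

variable [CompactSpace M]

/-- The balls of geodesic radius at most `rollingRadius` that touch the surface from the side of `N`
do not contain points of the surface in their interior. -/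
theorem inner_normalExp_le (hι : IsSmoothEmbedding (𝓡 2) (𝓡 3) ∞ ι)
    (hN : IsUnitNormalField ι N) (hmin : IsMinimalSurface ι N) {p : M × ℝ}
    (hp : p.2 ∈ Icc 0 (rollingRadius ι N)) (y : M) :
    inner ℝ (normalExp ι N hN p : E4) (ι y : E4) ≤ cos p.2 := by
  obtain ⟨x, t⟩ := p
  rw [inner_normalExp]
  have hΛ := maxPrincipalCurvature_nonneg hι hN hmin
  rcases eq_or_lt_of_le hp.1 with h0 | h0
  · have h0' : t = 0 := h0.symm
    simp only [h0', cos_zero, sin_zero]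
    linarith [inner_S3_le_one (ι x) (ι y)]
  have hIoo : ∀ s ∈ Ioo 0 (rollingRadius ι N),
      cos s * inner ℝ (ι x : E4) (ι y : E4) + sin s * inner ℝ (N x : E4) (ι y : E4) ≤ cos s := by
    intro s hs
    obtain ⟨h1, h2, h3⟩ := cot_bounds_of_lt_rollingRadius hΛ hs.1 hs.2
    have h4 := mul_nonneg h1.le (ballDefect_nonneg hι hN hmin h2 h3 x y)
    have h5 : sin s * (cos s / sin s) = cos s := mul_div_cancel₀ _ h1.ne'
    rw [ballDefect, mul_sub, ← mul_assoc, h5] at h4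
    linarith
  have hcl : IsClosed {s : ℝ | cos s * inner ℝ (ι x : E4) (ι y : E4)
      + sin s * inner ℝ (N x : E4) (ι y : E4) ≤ cos s} :=
    isClosed_le (by fun_prop) (by fun_prop)
  -- The endpoint `t = rollingRadius ι N`, where the strict curvature bound may fail, is reached by
  -- continuity.
  have h6 := hcl.closure_subset_iff.2 hIoo
  rw [closure_Ioo (h0.trans_le hp.2).ne] at h6
  exact h6 hp

/-- Each of the two balls about the common point excludes the other foot point, so the radii agree
and both feet lie on one sphere; enlarging the ball at `p.1` would put `ι q.1` inside. Only `p`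
needs room to enlarge; allowing `q.2` to be the endpoint is what the compactness argument in
`mainTheorem4` uses. -/
theorem normalExp_eq_imp_eq (hι : IsSmoothEmbedding (𝓡 2) (𝓡 3) ∞ ι)
    (hN : IsUnitNormalField ι N) (hmin : IsMinimalSurface ι N) {p q : M × ℝ}
    (hp : p.2 ∈ Ico 0 (rollingRadius ι N)) (hq : q.2 ∈ Icc 0 (rollingRadius ι N))
    (hpq : normalExp ι N hN p = normalExp ι N hN q) : p = q := by
  have hπ := pi_pos
  have hc4 : rollingRadius ι N ≤ π / 4 := min_le_right _ _
  have h1 := inner_normalExp_le hι hN hmin hq p.1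
  have h2 := inner_normalExp_le hι hN hmin (Ico_subset_Icc_self hp) q.1
  rw [← hpq, inner_normalExp_self] at h1
  rw [hpq, inner_normalExp_self] at h2
  have ht : p.2 = q.2 := injOn_cos ⟨hp.1, by linarith [hp.2]⟩ ⟨hq.1, by linarith [hq.2]⟩
    (le_antisymm h1 h2)
  refine Prod.ext (hι.isEmbedding.injective ?_) ht
  by_contra hne
  have hlt := inner_S3_lt_one hne
  have h3 := inner_normalExp_self hN q
  rw [← hpq, inner_normalExp, ← ht] at h3
  rcases eq_or_lt_of_le hp.1 with h0 | h0
  · rw [← h0, cos_zero, sin_zero] at h3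
    linarith
  · obtain ⟨t', ht1, ht2⟩ := exists_between hp.2
    have h4 := inner_normalExp_le hι hN hmin (p := (p.1, t')) ⟨h0.le.trans ht1.le, ht2.le⟩ q.1
    rw [inner_normalExp] at h4
    simp only at h4
    have hs : 0 < sin p.2 := sin_pos_of_pos_of_lt_pi h0 (by linarith [hp.2])
    have hd : 0 < sin (t' - p.2) := sin_pos_of_pos_of_lt_pi (by linarith) (by linarith)
    rw [sin_sub] at hd
    have hs' : 0 < sin t' := sin_pos_of_pos_of_lt_pi (by linarith) (by linarith)
    have h5 : sin p.2 * (cos t' * (1 - inner ℝ (ι p.1 : E4) (ι q.1 : E4)))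
        - sin t' * (cos p.2 * (1 - inner ℝ (ι p.1 : E4) (ι q.1 : E4))) ≥ 0 := by
      have := mul_nonneg hs.le (sub_nonneg.2 h4)
      have h6 : sin p.2 * inner ℝ (N p.1 : E4) (ι q.1 : E4)
        = cos p.2 * (1 - inner ℝ (ι p.1 : E4) (ι q.1 : E4)) := by linarith
      rw [← h6]
      linarith
    nlinarith

end RollingRadius

end

/-! ### Assembling the diffeomorphism. -/

theorem mainTheorem4 {M : Type*} [TopologicalSpace M] [CompactSpace M] [Nonempty M]
    [ChartedSpace (EuclideanSpace ℝ (Fin 2)) M] [IsManifold (𝓡 2) ∞ M]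
    (ι : M → S3) (hι : IsSmoothEmbedding (𝓡 2) (𝓡 3) ∞ ι)
    (N : M → S3) (hN : IsUnitNormalField ι N) (hmin : IsMinimalSurface ι N) :
    IsDiffeoOntoImageOn ((𝓡 2).prod 𝓘(ℝ, ℝ)) (𝓡 3)
      (normalExp ι N hN) (univ ×ˢ Ico 0 (rollingRadius ι N)) := by
  have hsm := contMDiff_normalExp hι.isImmersion.contMDiff hN
  have hΛ := maxPrincipalCurvature_nonneg hι hN hmin
  refine ⟨hsm.contMDiffOn, fun p hp q hq h =>
    normalExp_eq_imp_eq hι hN hmin hp.2 (Ico_subset_Icc_self hq.2) h, ?_⟩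
  rintro ⟨x, t⟩ ⟨-, ht⟩
  have hpos : ∀ w : TangentSpace (𝓡 2) x, w ≠ 0 →
      0 < cos t * inner ℝ (ambientDeriv ι x w) (ambientDeriv ι x w)
        + sin t * inner ℝ (ambientDeriv ι x w) (ambientDeriv N x w) := by
    intro w hw
    rcases eq_or_lt_of_le ht.1 with h0 | h0
    · have h0' : t = 0 := h0.symm
      rw [h0', cos_zero, sin_zero, one_mul, zero_mul, add_zero]
      exact firstFundamentalForm_pos hι.isImmersion x hw
    · obtain ⟨h1, -, h3⟩ := cot_bounds_of_lt_rollingRadius hΛ h0 ht.2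
      have h4 := (le_ciSup (bddAbove_nonnegPrincipalCurvature hι hN hmin) x).trans_lt h3
      have h5 := mul_pos h1 (pos_of_nonnegPrincipalCurvature_lt hι.isImmersion hN hmin h4 hw)
      rwa [mul_add, ← mul_assoc, mul_div_cancel₀ _ h1.ne'] at h5
  obtain ⟨U, g, hU, hxU, hg, hinv⟩ := exists_local_inverse_normalExp hι.isImmersion hN hpos
  obtain ⟨V, hVsub, hV, hxV⟩ := mem_nhds_iff.1 hinv
  -- The local inverse is only known to invert on `V`. Points outside `V`, with the endpoint
  -- included for compactness, have closed image, and removing this image from `U` leaves no stray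
  -- preimages; injectivity keeps `F(x, t)` itself.
  have hK : IsCompact ((univ ×ˢ Icc 0 (rollingRadius ι N)) \ V) :=
    (isCompact_univ.prod isCompact_Icc).diff hV
  have hFK := (hK.image hsm.continuous).isClosed
  refine ⟨U ∩ (normalExp ι N hN '' ((univ ×ˢ Icc 0 (rollingRadius ι N)) \ V))ᶜ, g,
    hU.inter hFK.isOpen_compl, ⟨hxU, ?_⟩, hg.mono inter_subset_left, ?_⟩
  · rintro ⟨q, ⟨⟨-, hq⟩, hqV⟩, hqx⟩
    exact hqV (normalExp_eq_imp_eq hι hN hmin ht hq hqx.symm ▸ hxV)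
  · rintro y ⟨-, hy⟩ ⟨-, hyK⟩
    by_contra hne
    exact hyK ⟨y, ⟨⟨trivial, Ico_subset_Icc_self hy⟩, fun hyV => hne (hVsub hyV)⟩, rfl⟩
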